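/- **Theorem 1.4.** All graphs are finite and simple. For a graph $G$ and $D\subseteq V(G)$, let $N[D]$ be the set of vertices of $D$ and all their neighbours. For a graph $F$, the $F$-isolation number $\iota(G,F)$ is the smallest size of a set $D\subseteq V(G)$ such that no (not necessarily induced) subgraph of $G-N[D]$ is a copy of $F$. Write $\iota(G)=\iota(G,K_2)$ and $\iota_k(G)=\iota(G,K_{1,k})$, where $K_{1,k}$ is the star with $k$ edges. A leaf is a vertex of degree $1$. Let $T$ be a tree with $n$ vertices and $\ell$ leaves. (a) If $T$ is not a star $K_{1,m}$ with $m\ge 1$, then $$\iota(T)\le\begin{cases}\frac{n+\ell}{4}<\frac n3 & \text{if } \ell<\frac n3,\\[2pt] \frac{n+\ell}{4}=\frac{n-\ell}{2}=\frac n3 & \text{if } \ell=\frac n3,\\[2pt] \frac{n-\ell}{2}<\frac n3 & \text{if } \ell>\frac n3.\end{cases}$$ (b) If $k\ge 2$ and $T$ is not a star $K_{1,m}$ with $m\ge k$, then $$\iota_k(T)\le\begin{cases}\frac{n+\ell}{2k+1}<\frac n{k+2} & \text{if } \ell<\frac{k-1}{k+2}n,\\[2pt] \frac{n+\ell}{2k+1}=\frac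 n{k+2} & \text{if } \ell=\frac{k-1}{k+2}n,\\[2pt] \frac n{k+2} & \text{if } \frac{k-1}{k+2}n<\ell<\frac{k}{k+2}n,\\[2pt] \frac{n-\ell}{2}=\frac n{k+2} & \text{if } \ell=\frac{k}{k+2}n,\\[2pt] \frac{n-\ell}{2}<\frac n{k+2} & \text{if } \ell>\frac{k}{k+2}n.\end{cases}$$ Moreover, the bounds are sharp, in each of the ranges and for every $k$: for every integer $r\ge r_0$ there is a tree $T$ whose $n$ and $\ell$ lie in the range in question, for which the bound of that range is attained, and for which the isolation number ($\iota(T)$ in (a), $\iota_k(T)$ in (b)) equals $r$. Here $r_0=3,2,1$ for the three ranges of (a), in the order displayed, and $r_0=3,2,2,1,1$ for the five ranges of (b), for every $k\ge2$. -/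

import Mathlib

namespace Isolation

universe u v

variable {V : Type u} {W : Type v}

/-- The closed neighbourhood `N[D]`: the vertices of `D` together with all their neighbours. -/
def closedNbhd (G : SimpleGraph V) (D : Set V) : Set V :=
  {v | v ∈ D ∨ ∃ u ∈ D, G.Adj u v}

/-- `D` is `F`-isolating in `G`: no (not necessarily induced) subgraph of `G - N[D]` is a copy
of `F`. -/
def IsIsolating (F : SimpleGraph W) (G : SimpleGraph V) (D : Set V) : Prop :=
  F.Free (G.induce (closedNbhd G D)ᶜ)

/-- The `F`-isolation number `ι(G, F)`: the size of a smallest `F`-isolating set of vertices. -/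
noncomputable def isolationNumber (F : SimpleGraph W) (G : SimpleGraph V) : ℕ :=
  sInf {m | ∃ D : Finset V, D.card = m ∧ IsIsolating F G (D : Set V)}

/-- The star `K_{1,k}` with `k` edges. -/
def star (k : ℕ) : SimpleGraph (Fin (k + 1)) := SimpleGraph.starGraph 0

/-- The isolation number `ι(G) = ι(G, K_2)`. -/
noncomputable def iota (G : SimpleGraph V) : ℕ :=
  isolationNumber (⊤ : SimpleGraph (Fin 2)) G

/-- The `k`-isolation number `ι_k(G) = ι(G, K_{1,k})`. -/
noncomputable def iotaStar (k : ℕ) (G : SimpleGraph V) : ℕ :=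
  isolationNumber (star k) G

/-- The number of leaves of `G`, a leaf being a vertex with exactly one neighbour. -/
noncomputable def leafOrder (G : SimpleGraph V) : ℕ :=
  {v | ∃! w, G.Adj v w}.ncard

/-- `G` is a star with at least `k` edges. -/
def IsStarWithAtLeast (k : ℕ) (G : SimpleGraph V) : Prop :=
  ∃ m, k ≤ m ∧ Nonempty (G ≃g star m)

end Isolation

open Isolation

/-! The theorem combines three upper bounds for a tree with `n` vertices and `ℓ` leaves with combs
that attain them.

The bound `2ι + ℓ ≤ n` (`two_mul_iotaStar_add_leafOrder_le`) comes from the bipartition. Unless the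
tree is a star, every vertex has a neighbour that is not a leaf. The non-leaves in either colour
class then dominate all non-leaves, and what remains is a set of isolated leaves. The smaller class
has at most `(n - ℓ) / 2` vertices.

The bounds `(k + 2)ι ≤ n` and `(2k + 1)ι ≤ n + ℓ`, with `4` in place of `2k + 1` when `k = 1`, use
greedy induction on a rooted tree. Take a deepest branch that still contains `K_{1,k}`, at a vertex
`c`, and put the parent `p` of `c` into `D` (`Rooting.exists_isolating_vertex`). Since `p` isolates
its own branch, that branch can be cut off. It has at least `k + 2` vertices, and its vertices and
ends together pay for the coefficient `2k + 1` (`Rooting.exists_isolatesOn_card`,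
`Rooting.exists_isolatesOn_ends`). The ranges of `ℓ` record which of the three bounds is smallest.

For sharpness, an isolating set must meet the closed neighbourhood of every copy of the star, so `r`
disjoint such neighbourhoods force `ι ≥ r` (`le_iotaStar_of_packing`). Combs give room to choose the
number of vertices and leaves spent on each star. -/

open Isolation

namespace Isolation

open Finset Classical

/-! ### Star-freeness by degrees, and isolation restricted to a vertex set -/

section Basic

variable {V : Type*} {W : Type*}

/-- The number of neighbours of `x` that lie in `U`. -/
noncomputable def degIn (G : SimpleGraph V) (U : Finset V) (x : V) : ℕ :=
  #{y ∈ U | G.Adj x y}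

/-- No vertex of `U` has `k` neighbours inside `U`. -/
def StarFreeOn (k : ℕ) (G : SimpleGraph V) (U : Finset V) : Prop :=
  ∀ x ∈ U, degIn G U x < k

lemma degIn_mono (G : SimpleGraph V) {A B : Finset V} (h : A ⊆ B) (x : V) :
    degIn G A x ≤ degIn G B x :=
  card_le_card (filter_subset_filter _ h)

lemma degIn_lt_card (G : SimpleGraph V) {A : Finset V} {x : V} (hx : x ∈ A) :
    degIn G A x < #A :=
  card_lt_card (filter_ssubset.2 ⟨x, hx, G.irrefl⟩)

lemma StarFreeOn.mono {k : ℕ} {G : SimpleGraph V} {A B : Finset V} (hB : StarFreeOn k G B)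
    (h : A ⊆ B) : StarFreeOn k G A :=
  fun x hx ↦ (degIn_mono G h x).trans_lt (hB x (h hx))

lemma starFreeOn_of_card_le {k : ℕ} {G : SimpleGraph V} {A : Finset V} (h : #A ≤ k) :
    StarFreeOn k G A :=
  fun _ hx ↦ (degIn_lt_card G hx).trans_le h

lemma StarFreeOn.union {k : ℕ} {G : SimpleGraph V} {A B : Finset V} (hA : StarFreeOn k G A)
    (hB : StarFreeOn k G B) (hAB : ∀ a ∈ A, ∀ b ∈ B, ¬ G.Adj a b) : StarFreeOn k G (A ∪ B) := by
  intro x hx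
  rcases mem_union.1 hx with h | h
  · refine lt_of_le_of_lt (card_le_card fun y hy ↦ ?_) (hA x h)
    simp only [mem_filter, mem_union] at hy ⊢
    exact ⟨hy.1.resolve_right fun hb ↦ hAB x h y hb hy.2, hy.2⟩
  · refine lt_of_le_of_lt (card_le_card fun y hy ↦ ?_) (hB x h)
    simp only [mem_filter, mem_union] at hy ⊢
    exact ⟨hy.1.resolve_left fun ha ↦ hAB y ha x h hy.2.symm, hy.2⟩

/-- `D` isolates the stars `K_{1,k}` of the part of `G` that lies on `S`. -/
def IsolatesOn (k : ℕ) (G : SimpleGraph V) (S D : Finset V) : Prop :=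
  StarFreeOn k G {x ∈ S | x ∉ closedNbhd G (D : Set V)}

lemma IsolatesOn.mono {k : ℕ} {G : SimpleGraph V} {S D D' : Finset V} (h : IsolatesOn k G S D)
    (hD : D ⊆ D') : IsolatesOn k G S D' := by
  refine StarFreeOn.mono h fun x hx ↦ ?_
  simp only [mem_filter] at hx ⊢
  refine ⟨hx.1, fun h ↦ hx.2 ?_⟩
  rcases h with h | ⟨u, hu, h⟩
  · exact Or.inl (hD h)
  · exact Or.inr ⟨u, hD hu, h⟩

lemma mem_closedNbhd_insert {G : SimpleGraph V} {D : Finset V} {p x : V}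
    (h : x = p ∨ G.Adj p x) : x ∈ closedNbhd G (insert p D : Finset V) := by
  rcases h with rfl | h
  · exact Or.inl (by simp)
  · exact Or.inr ⟨p, by simp, h⟩

lemma star_isContained_induce_iff {k : ℕ} {G : SimpleGraph V} [Fintype V] {A : Set V} :
    (star k).IsContained (G.induce A) ↔ ∃ x ∈ A, k ≤ degIn G {y | y ∈ A} x := by
  constructor
  · rintro ⟨f⟩
    refine ⟨f 0, (f 0).2, ?_⟩
    have : #(univ.image fun i : Fin k ↦ (f i.succ : V)) = k := by
      rw [card_image_of_injective, card_univ, Fintype.card_fin]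
      intro i j hij
      exact Fin.succ_injective _ (f.injective (Subtype.ext hij))
    refine this.symm.trans_le (card_le_card fun y hy ↦ ?_)
    obtain ⟨i, -, rfl⟩ := mem_image.1 hy
    simp only [mem_filter, mem_univ, true_and]
    refine ⟨(f i.succ).2, ?_⟩
    have h : (star k).Adj 0 i.succ := by
      simp [star, SimpleGraph.starGraph_adj, (Fin.succ_ne_zero i).symm]
    exact f.toHom.map_adj h
  · rintro ⟨x, hx, hk⟩
    obtain ⟨s, hs, hsk⟩ := exists_subset_card_eq hk
    let e : Fin k ≃ s := (Fintype.equivFinOfCardEq (by simpa using hsk)).symm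
    have he : ∀ i, (e i : V) ∈ A ∧ G.Adj x (e i) := fun i ↦ by
      simpa using hs (e i).2
    let f : Fin (k + 1) → A := Fin.cons ⟨x, hx⟩ fun i ↦ ⟨e i, (he i).1⟩
    refine ⟨⟨⟨f, ?_⟩, ?_⟩⟩
    · intro i j hij
      obtain ⟨hne, h⟩ := SimpleGraph.starGraph_adj.1 hij
      rcases h with rfl | rfl
      · obtain ⟨j, rfl⟩ := Fin.exists_succ_eq.2 hne.symm
        simpa [f] using (he j).2
      · obtain ⟨i, rfl⟩ := Fin.exists_succ_eq.2 hne
        simpa [f] using (he i).2.symm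
    · change Function.Injective f
      refine Fin.cons_injective_iff.2 ⟨?_, ?_⟩
      · rintro ⟨i, hi⟩
        exact (he i).2.ne (congrArg Subtype.val hi).symm
      · intro i j hij
        exact e.injective (Subtype.ext (congrArg (fun a : A ↦ (a : V)) hij))

lemma isIsolating_star_iff {k : ℕ} {G : SimpleGraph V} [Fintype V] {D : Finset V} :
    IsIsolating (star k) G (D : Set V) ↔ IsolatesOn k G univ D := by
  rw [IsIsolating, SimpleGraph.Free, star_isContained_induce_iff, IsolatesOn, StarFreeOn]
  simp only [Set.mem_compl_iff, not_exists, not_and, not_le, mem_filter, mem_univ, true_and]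

lemma star_one : star 1 = (⊤ : SimpleGraph (Fin 2)) := by
  ext a b
  simp only [star, SimpleGraph.starGraph_adj, SimpleGraph.top_adj]
  fin_cases a <;> fin_cases b <;> simp

lemma iota_eq_iotaStar_one (G : SimpleGraph V) : iota G = iotaStar 1 G := by
  rw [iota, iotaStar, star_one]

lemma iotaStar_le {k : ℕ} {G : SimpleGraph V} [Fintype V] {D : Finset V}
    (h : IsolatesOn k G univ D) : iotaStar k G ≤ #D :=
  Nat.sInf_le ⟨D, rfl, isIsolating_star_iff.2 h⟩

lemma le_iotaStar {k r : ℕ} {G : SimpleGraph V} [Fintype V]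
    (h : ∀ D, IsolatesOn k G univ D → r ≤ #D) : r ≤ iotaStar k G := by
  refine le_csInf ⟨_, univ, rfl, isIsolating_star_iff.2 ?_⟩ ?_
  · intro x hx
    simp [closedNbhd] at hx
  · rintro _ ⟨D, rfl, hD⟩
    exact h D (isIsolating_star_iff.1 hD)

lemma isIsolating_map_iso {U : Type*} {F : SimpleGraph U} {G : SimpleGraph V} {H : SimpleGraph W}
    (e : G ≃g H) {D : Finset V} (hD : IsIsolating F G (D : Set V)) :
    IsIsolating F H (D.map e.toEquiv.toEmbedding : Finset W) := by
  refine fun hc ↦ hD (hc.trans ⟨⟨⟨fun x ↦ ⟨e.symm x, ?_⟩, ?_⟩, ?_⟩⟩)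
  · rintro (h | ⟨u, hu, h⟩)
    · exact x.2 (Or.inl (by simpa using ⟨_, h, e.apply_symm_apply x⟩))
    · refine x.2 (Or.inr ⟨e u, by simpa using hu, ?_⟩)
      simpa using e.map_adj_iff.2 h
  · intro a b h
    exact e.symm.map_adj_iff.2 h
  · intro a b h
    exact Subtype.ext (e.symm.injective (Subtype.ext_iff.1 h))

lemma isolationNumber_congr {U : Type*} {G : SimpleGraph V} {H : SimpleGraph W} (e : G ≃g H)
    (F : SimpleGraph U) : isolationNumber F G = isolationNumber F H := by
  refine congrArg sInf (Set.ext fun m ↦ ⟨?_, ?_⟩)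
  · rintro ⟨D, rfl, hD⟩
    exact ⟨_, card_map _, isIsolating_map_iso e hD⟩
  · rintro ⟨D, rfl, hD⟩
    exact ⟨_, card_map _, isIsolating_map_iso e.symm hD⟩

lemma leafOrder_congr {G : SimpleGraph V} {H : SimpleGraph W} (e : G ≃g H) :
    leafOrder G = leafOrder H := by
  have : {w | ∃! x, H.Adj w x} = e '' {v | ∃! x, G.Adj v x} := by
    ext w
    obtain ⟨v, rfl⟩ := e.surjective w
    rw [e.injective.mem_set_image, Set.mem_ofPred_eq, Set.mem_ofPred_eq,
      ← e.toEquiv.existsUnique_congr_right]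
    exact existsUnique_congr fun x ↦ e.map_adj_iff
  rw [leafOrder, leafOrder, this, Set.ncard_image_of_injective _ e.injective]

end Basic

/-! ### Rooted trees and the greedy induction -/

/-- A presentation of a graph as a rooted tree: every vertex but the root is joined to its parent,
and there are no other edges. -/
structure Rooting {V : Type*} (G : SimpleGraph V) where
  /-- the root -/
  root : V
  /-- the parent of a vertex, the root being its own parent -/
  parent : V → V
  /-- the distance from the root -/
  depth : V → ℕ
  parent_root : parent root = root
  depth_parent : ∀ v, v ≠ root → depth (parent v) + 1 = depth v
  adj_iff : ∀ u v, G.Adj u v ↔ (u ≠ root ∧ parent u = v) ∨ (v ≠ root ∧ parent v = u)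

namespace Rooting

variable {V : Type*} {G : SimpleGraph V} (R : Rooting G)

/-- `x` is `p` or a descendant of `p`. -/
def Desc (p x : V) : Prop := ∃ m, R.parent^[m] x = p

variable {R} {k : ℕ} {S : Finset V} {p q x y z c : V}

lemma adj_parent (h : x ≠ R.root) : G.Adj (R.parent x) x :=
  (R.adj_iff _ _).2 (Or.inr ⟨h, rfl⟩)

@[refl] lemma Desc.refl (x : V) : R.Desc x x := ⟨0, rfl⟩

lemma Desc.of_parent (h : R.Desc p (R.parent x)) : R.Desc p x := by
  obtain ⟨m, hm⟩ := h
  exact ⟨m + 1, hm⟩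

lemma Desc.eq_or_parent (h : R.Desc p x) : x = p ∨ R.Desc p (R.parent x) := by
  obtain ⟨m, hm⟩ := h
  cases m with
  | zero => exact Or.inl hm
  | succ m => exact Or.inr ⟨m, hm⟩

lemma Desc.trans (h : R.Desc p q) (h' : R.Desc q x) : R.Desc p x := by
  obtain ⟨m, rfl⟩ := h
  obtain ⟨l, rfl⟩ := h'
  exact ⟨m + l, Function.iterate_add_apply _ _ _ _⟩

lemma depth_parent_le (x : V) : R.depth (R.parent x) ≤ R.depth x := by
  by_cases h : x = R.root
  · rw [h, R.parent_root]
  · exact (R.depth_parent x h) ▸ Nat.le_succ _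

lemma Desc.depth_le (h : R.Desc p x) : R.depth p ≤ R.depth x := by
  obtain ⟨m, rfl⟩ := h
  induction m generalizing x with
  | zero => rfl
  | succ m ih => exact ih.trans (depth_parent_le x)

lemma not_desc_parent (h : x ≠ R.root) : ¬ R.Desc x (R.parent x) := fun hd ↦ by
  have := hd.depth_le
  have := R.depth_parent x h
  omega

lemma desc_root (x : V) : R.Desc R.root x := by
  induction hn : R.depth x using Nat.strong_induction_on generalizing x with
  | _ n ih =>
    by_cases h : x = R.root
    · exact h ▸ Desc.refl _
    · exact (ih _ (by have := R.depth_parent x h; omega) _ rfl).of_parent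

lemma Desc.total (h : R.Desc p x) (h' : R.Desc q x) : R.Desc p q ∨ R.Desc q p := by
  obtain ⟨m, rfl⟩ := h
  obtain ⟨l, rfl⟩ := h'
  rcases le_total m l with hml | hml
  · exact Or.inr ⟨l - m, by rw [← Function.iterate_add_apply, Nat.sub_add_cancel hml]⟩
  · exact Or.inl ⟨m - l, by rw [← Function.iterate_add_apply, Nat.sub_add_cancel hml]⟩

lemma eq_of_desc_of_parent_eq (hx : x ≠ R.root) (hxy : R.parent x = R.parent y) (h : R.Desc x y) : x = y := by
  rcases h.eq_or_parent with h | h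
  · exact h.symm
  · exact absurd (hxy ▸ h) (not_desc_parent hx)

lemma eq_of_desc_common (hx : x ≠ R.root) (hy : y ≠ R.root)
    (hxy : R.parent x = R.parent y) (h : R.Desc x z) (h' : R.Desc y z) : x = y := by
  rcases h.total h' with h | h
  · exact eq_of_desc_of_parent_eq hx hxy h
  · exact (eq_of_desc_of_parent_eq hy hxy.symm h).symm

lemma Desc.exists_child (h : R.Desc p x) (hne : x ≠ p) :
    ∃ c, c ≠ R.root ∧ R.parent c = p ∧ R.Desc c x := by
  induction hn : R.depth x using Nat.strong_induction_on generalizing x with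
  | _ n ih =>
    have hx : x ≠ R.root := by
      rintro rfl
      obtain ⟨m, hm⟩ := h
      exact hne (hm ▸ (Function.iterate_fixed R.parent_root m).symm)
    by_cases hp : R.parent x = p
    · exact ⟨x, hx, hp, Desc.refl x⟩
    · obtain ⟨c, h1, h2, h3⟩ := ih _ (by have := R.depth_parent x hx; omega)
        (h.eq_or_parent.resolve_left hne) hp rfl
      exact ⟨c, h1, h2, h3.of_parent⟩

variable (R)

/-- `S` contains the parent of each of its vertices. -/
def IsLower (S : Finset V) : Prop := ∀ x ∈ S, R.parent x ∈ S

/-- The vertices of `S` that are `p` or descendants of `p`. -/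
noncomputable def sub (S : Finset V) (p : V) : Finset V := {x ∈ S | R.Desc p x}

/-- The children of `x` that lie in `S`. -/
noncomputable def children (S : Finset V) (x : V) : Finset V :=
  {y ∈ S | y ≠ R.root ∧ R.parent y = x}

/-- The vertices of `S` without children in `S`. -/
noncomputable def ends (S : Finset V) : Finset V := {x ∈ S | R.children S x = ∅}

variable {R}

lemma mem_sub : x ∈ R.sub S p ↔ x ∈ S ∧ R.Desc p x := mem_filter

lemma mem_children : x ∈ R.children S p ↔ x ∈ S ∧ x ≠ R.root ∧ R.parent x = p := mem_filter

lemma mem_ends : x ∈ R.ends S ↔ x ∈ S ∧ R.children S x = ∅ := mem_filter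

lemma sub_subset (S : Finset V) (p : V) : R.sub S p ⊆ S := filter_subset _ _

lemma sub_subset_sub (h : R.Desc p q) : R.sub S q ⊆ R.sub S p := fun _ hx ↦
  mem_sub.2 ⟨(mem_sub.1 hx).1, h.trans (mem_sub.1 hx).2⟩

lemma desc_of_mem_children (h : c ∈ R.children S p) : R.Desc p c :=
  Desc.of_parent ((mem_children.1 h).2.2 ▸ Desc.refl _)

lemma not_desc_of_mem_children (h : c ∈ R.children S p) : ¬ R.Desc c p :=
  (mem_children.1 h).2.2 ▸ not_desc_parent (mem_children.1 h).2.1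

lemma IsLower.mem_of_desc (hS : R.IsLower S) (hx : x ∈ S) (h : R.Desc p x) : p ∈ S := by
  obtain ⟨m, rfl⟩ := h
  induction m generalizing x with
  | zero => exact hx
  | succ m ih => exact ih (hS x hx)

lemma IsLower.sdiff_sub (hS : R.IsLower S) (q : V) : R.IsLower (S \ R.sub S q) := by
  intro x hx
  simp only [mem_sdiff, mem_sub, not_and] at hx ⊢
  exact ⟨hS x hx.1, fun _ h ↦ hx.2 hx.1 h.of_parent⟩

lemma card_sub_lt (hp : p ∈ S) (hpq : R.Desc p q) (h : ¬ R.Desc q p) :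
    #(R.sub S q) + 1 ≤ #(R.sub S p) :=
  card_lt_card ⟨sub_subset_sub hpq, fun hs ↦ h (mem_sub.1 (hs (mem_sub.2 ⟨hp, Desc.refl p⟩))).2⟩

lemma card_children_lt (hx : x ∈ S) : #(R.children S x) + 1 ≤ #(R.sub S x) := by
  refine card_lt_card ⟨fun y hy ↦ mem_sub.2 ⟨(mem_children.1 hy).1, desc_of_mem_children hy⟩,
    fun hs ↦ ?_⟩
  exact not_desc_of_mem_children (hs (mem_sub.2 ⟨hx, Desc.refl x⟩)) (Desc.refl x)

lemma exists_mem_ends (hx : x ∈ S) : ∃ z ∈ R.ends S, R.Desc x z := by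
  obtain ⟨z, hz, hmax⟩ := exists_max_image (R.sub S x) R.depth ⟨x, mem_sub.2 ⟨hx, Desc.refl x⟩⟩
  refine ⟨z, mem_ends.2 ⟨(mem_sub.1 hz).1, ?_⟩, (mem_sub.1 hz).2⟩
  refine eq_empty_of_forall_notMem fun y hy ↦ ?_
  have h1 := hmax y (mem_sub.2 ⟨(mem_children.1 hy).1,
    (mem_sub.1 hz).2.trans (desc_of_mem_children hy)⟩)
  have h2 := R.depth_parent y (mem_children.1 hy).2.1
  rw [(mem_children.1 hy).2.2] at h2
  omega

lemma card_ends_sub_pos (hx : x ∈ S) : 1 ≤ #(R.sub S x ∩ R.ends S) := by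
  obtain ⟨z, hz, hd⟩ := exists_mem_ends (R := R) hx
  exact card_pos.2 ⟨z, mem_inter.2 ⟨mem_sub.2 ⟨(mem_ends.1 hz).1, hd⟩, hz⟩⟩

/-- Branches of distinct children are disjoint and each contains an end. -/
lemma card_children_le_card_ends_sub (S : Finset V) (x : V) :
    #(R.children S x) ≤ #(R.sub S x ∩ R.ends S) := by
  have h : ∀ y, ∃ z, y ∈ R.children S x → z ∈ R.ends S ∧ R.Desc y z := fun y ↦ by
    by_cases hy : y ∈ R.children S x
    · obtain ⟨z, hz⟩ := exists_mem_ends (R := R) (mem_children.1 hy).1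
      exact ⟨z, fun _ ↦ hz⟩
    · exact ⟨y, fun h ↦ absurd h hy⟩
  choose f hf using h
  refine card_le_card_of_injOn f (fun y hy ↦ ?_) fun y hy y' hy' hyy' ↦ ?_
  · obtain ⟨h1, h2⟩ := hf y hy
    exact mem_inter.2 ⟨mem_sub.2 ⟨(mem_ends.1 h1).1, (desc_of_mem_children hy).trans h2⟩, h1⟩
  · have h1 := mem_children.1 hy
    have h2 := mem_children.1 hy'
    exact eq_of_desc_common h1.2.1 h2.2.1 (h1.2.2.trans h2.2.2.symm) (hf y hy).2
      (hyy' ▸ (hf y' hy').2)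

lemma degIn_le_card_children_add_one (A : Finset V) (hA : A ⊆ S) (x : V) :
    degIn G A x ≤ #(R.children S x) + 1 := by
  refine (card_le_card (t := insert (R.parent x) (R.children S x)) fun y hy ↦ ?_).trans
    (card_insert_le _ _)
  obtain ⟨hyA, hxy⟩ := mem_filter.1 hy
  rcases (R.adj_iff _ _).1 hxy with h | h
  · exact mem_insert.2 (Or.inl h.2.symm)
  · exact mem_insert_of_mem (mem_children.2 ⟨hA hyA, h⟩)

lemma degIn_sub_self_le (S : Finset V) (x : V) : degIn G (R.sub S x) x ≤ #(R.children S x) := by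
  refine card_le_card fun y hy ↦ ?_
  obtain ⟨hyA, hxy⟩ := mem_filter.1 hy
  rcases (R.adj_iff _ _).1 hxy with h | h
  · exact absurd (h.2 ▸ (mem_sub.1 hyA).2) (not_desc_parent h.1)
  · exact mem_children.2 ⟨(mem_sub.1 hyA).1, h⟩

/-- A branch that contains a star `K_{1,k}` is large or has many ends. -/
lemma le_card_sub_add_card_ends {C : ℕ} (hC : C ≤ 2 * k + 1 ∨ k = 1 ∧ C ≤ 4) (hc : c ∈ S)
    (h : ¬ StarFreeOn k G (R.sub S c)) :
    C ≤ #(R.sub S c) + #(R.sub S c ∩ R.ends S) + 1 := by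
  simp only [StarFreeOn, not_forall, not_lt] at h
  obtain ⟨x, hx, hkx⟩ := h
  have hxS := (mem_sub.1 hx).1
  have h1 := card_children_lt (R := R) hxS
  have h2 := card_children_le_card_ends_sub (R := R) S x
  have h3 := card_ends_sub_pos (R := R) hxS
  by_cases hxc : x = c
  · subst hxc
    have := hkx.trans (degIn_sub_self_le S x)
    omega
  · have h4 := hkx.trans (degIn_le_card_children_add_one (R := R) _ (sub_subset S c) x)
    have hd := (mem_sub.1 hx).2
    have h5 := card_sub_lt hc hd fun h' ↦ by
      rcases h'.eq_or_parent with h' | h'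
      · exact hxc h'.symm
      · by_cases hcr : c = R.root
        · rw [hcr, R.parent_root] at h'
          obtain ⟨m, hm⟩ := h'
          exact hxc (hcr ▸ hm ▸ Function.iterate_fixed R.parent_root m)
        · exact not_desc_parent hcr (hd.trans h')
    have h6 : #(R.sub S x ∩ R.ends S) ≤ #(R.sub S c ∩ R.ends S) :=
      card_le_card (inter_subset_inter_right (sub_subset_sub hd))
    omega

/-- Deleting `p` and its neighbours splits the branch of `p` into pieces inside the branches of its
grandchildren. -/
lemma starFreeOn_sub_of_grandchildren (hS : R.IsLower S)
    (h : ∀ x ∈ S, x ≠ R.root → R.parent x ≠ R.root → R.parent (R.parent x) = p →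
      StarFreeOn k G (R.sub S x)) :
    StarFreeOn k G {y ∈ R.sub S p | ¬ (y = p ∨ G.Adj p y)} := by
  intro y hy
  obtain ⟨hys, hyp⟩ := mem_filter.1 hy
  obtain ⟨hyS, hd⟩ := mem_sub.1 hys
  obtain ⟨c, hcr, rfl, hdc⟩ := hd.exists_child fun h ↦ hyp (Or.inl h)
  have hyc : y ≠ c := fun hyc ↦ hyp (Or.inr (by
    rw [hyc]
    exact adj_parent hcr))
  obtain ⟨x, hxr, rfl, hdx⟩ := hdc.exists_child hyc
  refine lt_of_le_of_lt (card_le_card fun z hz ↦ ?_)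
    (h x (hS.mem_of_desc hyS hdx) hxr hcr rfl y (mem_sub.2 ⟨hyS, hdx⟩))
  obtain ⟨hz, hyz⟩ := mem_filter.1 hz
  obtain ⟨hzs, hzp⟩ := mem_filter.1 hz
  refine mem_filter.2 ⟨mem_sub.2 ⟨(mem_sub.1 hzs).1, ?_⟩, hyz⟩
  rcases (R.adj_iff _ _).1 hyz with h' | h'
  · rcases hdx.eq_or_parent with rfl | hx
    · obtain ⟨-, rfl⟩ := h'
      exact absurd (Or.inr (adj_parent hcr)) hzp
    · exact h'.2 ▸ hx
  · exact Desc.of_parent (h'.2 ▸ hdx)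

/-- If `S` contains a star, then some vertex `p` isolates its own branch, and the branch of a child
of `p` contains a star unless `p` is the root. -/
lemma exists_isolating_vertex (hS : R.IsLower S) (h : ¬ StarFreeOn k G S) :
    ∃ p ∈ S, StarFreeOn k G {y ∈ R.sub S p | ¬ (y = p ∨ G.Adj p y)} ∧
      (p = R.root ∨ ∃ c ∈ R.children S p, ¬ StarFreeOn k G (R.sub S c)) := by
  by_cases hc : ∃ c ∈ S, c ≠ R.root ∧ ¬ StarFreeOn k G (R.sub S c)
  · have hne : (S.filter fun c ↦ c ≠ R.root ∧ ¬ StarFreeOn k G (R.sub S c)).Nonempty := by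
      obtain ⟨c, hc⟩ := hc
      exact ⟨c, mem_filter.2 hc⟩
    -- Choose `c` deepest: the grandchildren of its parent lie one level deeper than `c`, so their
    -- branches are star-free.
    obtain ⟨c, hc, hmax⟩ := exists_max_image _ R.depth hne
    obtain ⟨hcS, hcr, hcd⟩ := mem_filter.1 hc
    refine ⟨R.parent c, hS c hcS, starFreeOn_sub_of_grandchildren hS fun x hx hxr hpr hxp ↦ ?_,
      Or.inr ⟨c, mem_children.2 ⟨hcS, hcr, rfl⟩, hcd⟩⟩
    by_contra hxd
    have h0 := hmax x (mem_filter.2 ⟨hx, hxr, hxd⟩)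
    have h1 := R.depth_parent x hxr
    have h2 := R.depth_parent _ hpr
    have h3 := R.depth_parent c hcr
    rw [hxp] at h2
    omega
  · have hr : R.root ∈ S := by
      simp only [StarFreeOn, not_forall] at h
      obtain ⟨x, hx, -⟩ := h
      exact hS.mem_of_desc hx (desc_root x)
    refine ⟨R.root, hr, starFreeOn_sub_of_grandchildren hS fun x hx hxr _ _ ↦ ?_, Or.inl rfl⟩
    by_contra hxd
    exact hc ⟨x, hx, hxr, hxd⟩

lemma sub_root (S : Finset V) : R.sub S R.root = S :=
  filter_true_of_mem fun x _ ↦ desc_root x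

/-- The only edge of the tree leaving the branch of `q` goes through `q`, which `p` dominates. Hence
the two sides can be treated separately. -/
lemma isolatesOn_insert {D : Finset V} (hq : q = p ∨ G.Adj p q)
    (hD : IsolatesOn k G (S \ R.sub S q) (insert p D))
    (hp : StarFreeOn k G {y ∈ R.sub S q | ¬ (y = p ∨ G.Adj p y)}) :
    IsolatesOn k G S (insert p D) := by
  have h2 : ∀ x, x ∉ closedNbhd G (insert p D : Finset V) → ¬ (x = p ∨ G.Adj p x) :=
    fun x hx h ↦ hx (mem_closedNbhd_insert h)
  have h3 : StarFreeOn k G {x ∈ R.sub S q | x ∉ closedNbhd G (insert p D : Finset V)} :=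
    hp.mono fun x hx ↦ mem_filter.2 ⟨(mem_filter.1 hx).1, h2 x (mem_filter.1 hx).2⟩
  refine (StarFreeOn.union hD h3 fun a ha b hb hab ↦ ?_).mono fun x hx ↦ ?_
  · obtain ⟨ha1, -⟩ := mem_filter.1 ha
    obtain ⟨hb1, hb2⟩ := mem_filter.1 hb
    obtain ⟨haS, haq⟩ := mem_sdiff.1 ha1
    rcases (R.adj_iff _ _).1 hab with h | h
    · exact haq (mem_sub.2 ⟨haS, Desc.of_parent (h.2 ▸ (mem_sub.1 hb1).2)⟩)
    · rcases (mem_sub.1 hb1).2.eq_or_parent with h' | h'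
      · exact h2 b hb2 (h' ▸ hq)
      · exact haq (mem_sub.2 ⟨haS, h.2 ▸ h'⟩)
  · by_cases hxq : x ∈ R.sub S q
    · exact mem_union_right _ (mem_filter.2 ⟨hxq, (mem_filter.1 hx).2⟩)
    · exact mem_union_left _ (mem_filter.2
        ⟨mem_sdiff.2 ⟨(mem_filter.1 hx).1, hxq⟩, (mem_filter.1 hx).2⟩)

lemma card_sdiff_sub_add (S : Finset V) (q : V) : #(S \ R.sub S q) + #(R.sub S q) = #S :=
  card_sdiff_add_card_eq_card (sub_subset S q)

lemma children_sdiff_sub (hx : x ∉ R.sub S q) (hxS : x ∈ S) :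
    R.children (S \ R.sub S q) x = (R.children S x).erase q := by
  ext y
  simp only [mem_erase, mem_children, mem_sdiff, mem_sub, not_and]
  constructor
  · rintro ⟨⟨h1, h2⟩, h3, h4⟩
    exact ⟨fun h ↦ h2 h1 (h ▸ Desc.refl _), h1, h3, h4⟩
  · rintro ⟨h0, h1, h3, h4⟩
    refine ⟨⟨h1, fun _ h ↦ ?_⟩, h3, h4⟩
    exact hx (mem_sub.2 ⟨hxS, h4 ▸ h.eq_or_parent.resolve_left h0⟩)

/-- Cutting a branch takes a child from the parent of `q` alone, so at most one new end arises. A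
sibling of `q` prevents even that. -/
lemma ends_sdiff_sub_subset (S : Finset V) (q : V) :
    R.ends (S \ R.sub S q) ⊆ insert (R.parent q) (R.ends S \ R.sub S q) := by
  intro x hx
  obtain ⟨hx, hch⟩ := mem_ends.1 hx
  obtain ⟨hxS, hxq⟩ := mem_sdiff.1 hx
  rw [children_sdiff_sub hxq hxS] at hch
  by_cases hqx : q ∈ R.children S x
  · exact mem_insert.2 (Or.inl (mem_children.1 hqx).2.2.symm)
  · rw [erase_eq_of_notMem hqx] at hch
    exact mem_insert_of_mem (mem_sdiff.2 ⟨mem_ends.2 ⟨hxS, hch⟩, hxq⟩)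

lemma card_ends_sdiff_sub_add (S : Finset V) (q : V) :
    #(R.ends S \ R.sub S q) + #(R.sub S q ∩ R.ends S) = #(R.ends S) := by
  rw [inter_comm, card_sdiff_add_card_inter]

lemma card_ends_sdiff_sub_le (S : Finset V) (q : V) :
    #(R.ends (S \ R.sub S q)) + #(R.sub S q ∩ R.ends S) ≤ #(R.ends S) + 1 := by
  have h1 := (card_le_card (ends_sdiff_sub_subset (R := R) S q)).trans (card_insert_le _ _)
  have h2 := card_ends_sdiff_sub_add (R := R) S q
  omega

lemma card_ends_sdiff_sub_le_of_sibling
    (h : q = R.root ∨ ∃ y ∈ R.children S (R.parent q), y ≠ q) :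
    #(R.ends (S \ R.sub S q)) + #(R.sub S q ∩ R.ends S) ≤ #(R.ends S) := by
  rw [← card_ends_sdiff_sub_add S q]
  refine Nat.add_le_add_right (card_le_card fun x hx ↦ ?_) _
  rcases mem_insert.1 (ends_sdiff_sub_subset S q hx) with rfl | h'
  · exfalso
    obtain ⟨hx, hch⟩ := mem_ends.1 hx
    obtain ⟨hxS, hxq⟩ := mem_sdiff.1 hx
    rcases h with rfl | ⟨y, hy, hyq⟩
    · exact hxq (mem_sub.2 ⟨hxS, desc_root _⟩)
    · rw [children_sdiff_sub hxq hxS] at hch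
      exact notMem_empty y (hch ▸ mem_erase.2 ⟨hyq, hy⟩)
  · exact h'

/-- The bound on the isolation number of a rooted tree in terms of its order and its ends. -/
theorem exists_isolatesOn_ends {C : ℕ} (hC : C ≤ 2 * k + 1 ∨ k = 1 ∧ C ≤ 4)
    (hS : R.IsLower S) : ∃ D, IsolatesOn k G S D ∧ C * #D ≤ #S + #(R.ends S) + 1 := by
  induction hn : #S using Nat.strong_induction_on generalizing S with
  | _ n ih =>
    subst hn
    by_cases hfree : StarFreeOn k G S
    · exact ⟨∅, hfree.mono (filter_subset _ _), by simp⟩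
    obtain ⟨p, hpS, hp, hpc⟩ := exists_isolating_vertex hS hfree
    -- The inductive step: `p` joins `D`, the branch of `q` is cut off, and the drop in vertices
    -- plus ends must be at least `C`.
    have step : ∀ q ∈ S, (q = p ∨ G.Adj p q) →
        StarFreeOn k G {y ∈ R.sub S q | ¬ (y = p ∨ G.Adj p y)} →
        C + #(R.ends (S \ R.sub S q)) ≤ #(R.sub S q) + #(R.ends S) →
        ∃ D, IsolatesOn k G S D ∧ C * #D ≤ #S + #(R.ends S) + 1 := by
      intro q hq hpq hfr hcard
      have h1 := card_sdiff_sub_add (R := R) S q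
      have h2 : 0 < #(R.sub S q) := card_pos.2 ⟨q, mem_sub.2 ⟨hq, Desc.refl q⟩⟩
      obtain ⟨D, hD, hDc⟩ := ih _ (by omega) (hS.sdiff_sub q) rfl
      refine ⟨insert p D, isolatesOn_insert hpq (hD.mono (subset_insert _ _)) hfr, ?_⟩
      have h3 := Nat.mul_le_mul_left C (card_insert_le p D)
      rw [Nat.mul_add, Nat.mul_one] at h3
      omega
    rcases hpc with rfl | ⟨c, hc, hcd⟩
    · rw [sub_root] at hp
      refine ⟨insert R.root ∅, hp.mono fun x hx ↦ ?_, ?_⟩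
      · obtain ⟨hxS, hx⟩ := mem_filter.1 hx
        refine mem_filter.2 ⟨hxS, ?_⟩
        exact fun h ↦ hx (mem_closedNbhd_insert (D := ∅) h)
      · have := le_card_sub_add_card_ends (R := R) hC hpS (by rwa [sub_root])
        rw [sub_root, inter_eq_right.2 (show R.ends S ⊆ S from filter_subset _ _)] at this
        simpa using this
    · have h1 := le_card_sub_add_card_ends hC (mem_children.1 hc).1 hcd
      have h2 := card_sub_lt hpS (desc_of_mem_children hc) (not_desc_of_mem_children hc)
      have h3 : #(R.sub S c ∩ R.ends S) ≤ #(R.sub S p ∩ R.ends S) :=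
        card_le_card (inter_subset_inter_right (sub_subset_sub (desc_of_mem_children hc)))
      -- Cutting at `p` is affordable if it creates no new end. If `p` is an only child, the cut is
      -- made at its parent, which `p` dominates; that additional vertex pays for the possible new
      -- end.
      by_cases hsib : p = R.root ∨ ∃ y ∈ R.children S (R.parent p), y ≠ p
      · refine step p hpS (Or.inl rfl) hp ?_
        have := card_ends_sdiff_sub_le_of_sibling hsib
        omega
      · push Not at hsib
        obtain ⟨hpr, hsib⟩ := hsib
        have hpg : p ∈ R.children S (R.parent p) := mem_children.2 ⟨hpS, hpr, rfl⟩
        have hadj := adj_parent hpr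
        refine step (R.parent p) (hS p hpS) (Or.inr hadj.symm) (hp.mono fun y hy ↦ ?_) ?_
        · obtain ⟨hy, hyp⟩ := mem_filter.1 hy
          obtain ⟨hyS, hyd⟩ := mem_sub.1 hy
          obtain ⟨c', h1, h2, h3⟩ := hyd.exists_child fun h ↦ hyp (Or.inr (h ▸ hadj.symm))
          have := hsib c' (mem_children.2 ⟨hS.mem_of_desc hyS h3, h1, h2⟩)
          exact mem_filter.2 ⟨mem_sub.2 ⟨hyS, this ▸ h3⟩, hyp⟩
        · have h4 := card_sub_lt (hS p hpS) (desc_of_mem_children hpg)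
            (not_desc_of_mem_children hpg)
          have h5 : #(R.sub S p ∩ R.ends S) ≤ #(R.sub S (R.parent p) ∩ R.ends S) :=
            card_le_card (inter_subset_inter_right (sub_subset_sub (desc_of_mem_children hpg)))
          have h6 := card_ends_sdiff_sub_le (R := R) S (R.parent p)
          omega

/-- The bound on the isolation number of a rooted tree in terms of its order. -/
theorem exists_isolatesOn_card (hS : R.IsLower S) (hcard : #S ≠ k + 1) :
    ∃ D, IsolatesOn k G S D ∧ (k + 2) * #D ≤ #S := by
  induction hn : #S using Nat.strong_induction_on generalizing S with
  | _ n ih =>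
    subst hn
    by_cases hfree : StarFreeOn k G S
    · exact ⟨∅, hfree.mono (filter_subset _ _), by simp⟩
    obtain ⟨p, hpS, hp, hpc⟩ := exists_isolating_vertex hS hfree
    have hSk : k + 2 ≤ #S := by
      by_contra h
      exact hfree (starFreeOn_of_card_le (by omega))
    rcases hpc with rfl | ⟨c, hc, hcd⟩
    · rw [sub_root] at hp
      refine ⟨insert R.root ∅, hp.mono fun x hx ↦ ?_, by simpa using hSk⟩
      obtain ⟨hxS, hx⟩ := mem_filter.1 hx
      refine mem_filter.2 ⟨hxS, ?_⟩
      exact fun h ↦ hx (mem_closedNbhd_insert (D := ∅) h)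
    · have h1 : k + 1 ≤ #(R.sub S c) := by
        by_contra h
        exact hcd (starFreeOn_of_card_le (by omega))
      have h2 := card_sub_lt hpS (desc_of_mem_children hc) (not_desc_of_mem_children hc)
      have h3 := card_sdiff_sub_add (R := R) S p
      -- Induction is unavailable for a remainder of `k + 1` vertices, which may be a star. But `p`
      -- also dominates its parent, and the other `k` vertices cannot contain `K_{1,k}`, so `p`
      -- alone suffices.
      by_cases h4 : #(S \ R.sub S p) = k + 1
      · refine ⟨insert p ∅, isolatesOn_insert (q := p) (R := R) (Or.inl rfl) ?_ hp,
          by simpa using hSk⟩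
        have hpr : p ≠ R.root := by
          rintro rfl
          simp [sub_root] at h4
        have hg : R.parent p ∈ S \ R.sub S p := mem_sdiff.2
          ⟨hS p hpS, fun h ↦ not_desc_parent hpr (mem_sub.1 h).2⟩
        refine (starFreeOn_of_card_le (A := (S \ R.sub S p).erase (R.parent p)) ?_).mono
          fun x hx ↦ ?_
        · rw [card_erase_of_mem hg, h4, Nat.add_sub_cancel]
        · obtain ⟨hx, hxp⟩ := mem_filter.1 hx
          exact mem_erase.2 ⟨fun h ↦ hxp (mem_closedNbhd_insert
            (Or.inr (h ▸ (adj_parent hpr).symm))), hx⟩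
      · obtain ⟨D, hD, hDc⟩ := ih _ (by omega) (hS.sdiff_sub p) h4 rfl
        refine ⟨insert p D, isolatesOn_insert (Or.inl rfl) (hD.mono (subset_insert _ _)) hp, ?_⟩
        have h3 := Nat.mul_le_mul_left (k + 2) (card_insert_le p D)
        rw [Nat.mul_add, Nat.mul_one] at h3
        omega

end Rooting

/-! ### The three upper bounds for trees -/

section Trees

variable {V : Type*} {G : SimpleGraph V}

/-- The parent is the penultimate vertex of the unique path from `r`, and the depth is the distance
from `r`. Adjacent vertices of a tree have distances differing by exactly one. -/
theorem exists_rooting (hG : G.IsTree) (r : V) : ∃ R : Rooting G, R.root = r := by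
  choose P hP hlen using fun v ↦ hG.connected.exists_path_of_dist r v
  have huniq : ∀ u v, G.Adj u v → G.dist r v = G.dist r u + 1 → (P v).penultimate = u := by
    intro u v huv hd
    have h := ((P u).concat huv).isPath_of_length_eq_dist (by
      rw [SimpleGraph.Walk.length_concat, hlen, hd])
    rw [(hG.existsUnique_path r v).unique (hP v) h, SimpleGraph.Walk.penultimate_concat]
  have hadj : ∀ v, v ≠ r → G.Adj (P v).penultimate v := fun v hv ↦
    (P v).adj_penultimate fun h ↦ hv h.eq.symm
  have hdist : ∀ v, v ≠ r → G.dist r (P v).penultimate + 1 = G.dist r v := by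
    intro v hv
    have h1 : 0 < (P v).length := by
      rw [hlen]
      exact hG.connected.pos_dist_of_ne hv.symm
    have h2 := SimpleGraph.dist_le (P v).dropLast
    rw [SimpleGraph.Walk.length_dropLast, hlen] at h2
    rcases hG.dist_eq_dist_add_one_of_adj r (hadj v hv) with h | h <;>
    · rw [hlen] at h1
      omega
  refine ⟨⟨r, fun v ↦ (P v).penultimate, G.dist r, ?_, hdist, fun u v ↦ ⟨fun h ↦ ?_, ?_⟩⟩, rfl⟩
  · rw [(hG.existsUnique_path r r).unique (hP r) SimpleGraph.Walk.IsPath.nil,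
      SimpleGraph.Walk.penultimate_nil]
  · rcases hG.dist_eq_dist_add_one_of_adj r h with h' | h'
    · refine Or.inl ⟨?_, huniq v u h.symm h'⟩
      rintro rfl
      simp at h'
    · refine Or.inr ⟨?_, huniq u v h h'⟩
      rintro rfl
      simp at h'
  · rintro (⟨h, rfl⟩ | ⟨h, rfl⟩)
    · exact (hadj u h).symm
    · exact hadj v h

theorem Rooting.isTree [Finite V] (R : Rooting G) : G.IsTree := by
  have hr : ∀ x, G.Reachable R.root x := by
    intro x
    induction hn : R.depth x using Nat.strong_induction_on generalizing x with
    | _ n ih =>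
      by_cases h : x = R.root
      · exact h ▸ SimpleGraph.Reachable.refl _
      · exact (ih _ (by have := R.depth_parent x h; omega) _ rfl).trans
          (Rooting.adj_parent h).reachable
  have hconn : G.Connected :=
    { preconnected := fun x y ↦ (hr x).symm.trans (hr y)
      nonempty := ⟨R.root⟩ }
  refine SimpleGraph.isTree_iff_connected_and_card.2
    ⟨hconn, le_antisymm ?_ hconn.card_vert_le_card_edgeSet_add_one⟩
  have h1 : G.edgeSet ⊆ (fun v ↦ s(R.parent v, v)) '' {R.root}ᶜ := by
    intro e
    induction e with
    | _ u v =>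
      intro h
      rcases (R.adj_iff _ _).1 (G.mem_edgeSet.1 h) with h | h
      · exact ⟨u, h.1, by simp [h.2, Sym2.eq_swap]⟩
      · exact ⟨v, h.1, by simp [h.2]⟩
  have h2 := (Set.ncard_le_ncard h1).trans (Set.ncard_image_le (Set.toFinite _))
  have h3 := Set.ncard_add_ncard_compl {R.root}
  rw [Set.ncard_singleton] at h3
  rw [Nat.card_coe_set_eq]
  omega

/-- A tree is minimal among connected graphs on its vertices, so it equals the spanning star that it
contains. -/
lemma isStarWithAtLeast_of_universal {k : ℕ} [Fintype V] (hG : G.IsTree) {x : V}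
    (hx : ∀ y, y ≠ x → G.Adj x y) (hk : k + 1 ≤ Fintype.card V) : IsStarWithAtLeast k G := by
  obtain ⟨m, hm⟩ : ∃ m, Fintype.card V = m + 1 := ⟨Fintype.card V - 1, by omega⟩
  have hle : SimpleGraph.starGraph x ≤ G := by
    intro a b h
    obtain ⟨hne, rfl | rfl⟩ := SimpleGraph.starGraph_adj.1 h
    · exact hx b hne.symm
    · exact (hx a hne).symm
  have heq : G = SimpleGraph.starGraph x :=
    le_antisymm ((SimpleGraph.isTree_iff_minimal_connected.1 hG).2
      (SimpleGraph.connected_starGraph x) hle) hle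
  refine ⟨m, by omega, ⟨?_⟩⟩
  let e : V ≃ Fin (m + 1) := Fintype.equivFinOfCardEq hm
  let e' : V ≃ Fin (m + 1) := e.trans (Equiv.swap (e x) 0)
  have hex : ∀ v, e' v = 0 ↔ v = x := fun v ↦ by
    rw [← e'.apply_eq_iff_eq (x := v)]
    simp [e']
  refine ⟨e', fun {a b} ↦ ?_⟩
  rw [heq]
  simp only [star, SimpleGraph.starGraph_adj, hex, ne_eq, e'.apply_eq_iff_eq]

/-- A walk cannot leave the closed neighbourhood of `x`, because each neighbour of `x` leads only
back to `x`. -/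
lemma adj_of_forall_adj_leaf (hG : G.Connected) {x : V}
    (hx : ∀ y, G.Adj x y → ∃! z, G.Adj y z) (y : V) (hy : y ≠ x) : G.Adj x y := by
  have key : ∀ u v, G.Walk u v → (u = x ∨ G.Adj x u) → (v = x ∨ G.Adj x v) := by
    intro u v p
    induction p with
    | nil => exact id
    | cons h p ih =>
      rintro (rfl | h')
      · exact ih (Or.inr h)
      · exact ih (Or.inl ((hx _ h').unique h h'.symm))
  obtain ⟨p⟩ := hG.preconnected x y
  exact (key x y p (Or.inl rfl)).resolve_left hy

lemma iotaStar_eq_zero {k : ℕ} [Fintype V] (h : StarFreeOn k G univ) : iotaStar k G = 0 :=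
  Nat.le_zero.1 ((iotaStar_le (D := ∅) (h.mono (filter_subset _ _))).trans_eq card_empty)

lemma leafOrder_eq_card [Fintype V] : leafOrder G = #{v | ∃! w, G.Adj v w} := by
  rw [leafOrder, ← Set.ncard_coe_finset]
  simp

lemma leafOrder_le_card [Fintype V] : leafOrder G ≤ Fintype.card V :=
  leafOrder_eq_card.trans_le (card_le_univ _)

theorem two_mul_iotaStar_add_leafOrder_le {k : ℕ} [Fintype V] (hG : G.IsTree) (hk : 1 ≤ k)
    (hstar : ¬ IsStarWithAtLeast k G) : 2 * iotaStar k G + leafOrder G ≤ Fintype.card V := by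
  by_cases hx : ∃ x, ∀ y, G.Adj x y → ∃! z, G.Adj y z
  · obtain ⟨x, hx⟩ := hx
    have hcard : Fintype.card V ≤ k := by
      by_contra h
      exact hstar (isStarWithAtLeast_of_universal hG (adj_of_forall_adj_leaf hG.connected hx)
        (by omega))
    rw [iotaStar_eq_zero (starFreeOn_of_card_le hcard)]
    simpa using leafOrder_le_card
  push Not at hx
  obtain ⟨R, -⟩ := exists_rooting hG hG.connected.nonempty.some
  have hpar : ∀ x y, G.Adj x y → (Even (R.depth x) ↔ ¬ Even (R.depth y)) := by
    intro x y h
    rcases (R.adj_iff _ _).1 h with ⟨h', rfl⟩ | ⟨h', rfl⟩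
    · rw [← R.depth_parent x h', Nat.even_add_one]
    · rw [← R.depth_parent y h', Nat.even_add_one, not_not]
  set N : Finset V := {v | ¬ ∃! w, G.Adj v w} with hN
  have hcard : #N + leafOrder G = Fintype.card V := by
    rw [leafOrder_eq_card, add_comm, hN, card_filter_add_card_filter_not, card_univ]
  -- `p` selects a colour class. A non-leaf outside it has a non-leaf neighbour inside it. An
  -- undominated vertex is therefore a leaf whose only neighbour is dominated.
  have key : ∀ p : V → Prop, (∀ x y, G.Adj x y → (p x ↔ ¬ p y)) →
      iotaStar k G ≤ #{v ∈ N | p v} := by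
    intro p hp
    refine iotaStar_le fun x hx' ↦ ?_
    have hdom : ∀ y, (¬ ∃! w, G.Adj y w) → y ∈ closedNbhd G ({v ∈ N | p v} : Finset V) := by
      intro y hy
      by_cases hpy : p y
      · exact Or.inl (by simp [hN, hy, hpy])
      · obtain ⟨z, hyz, hz⟩ := hx y
        refine Or.inr ⟨z, ?_, hyz.symm⟩
        simpa [hN, (hp z y hyz.symm).2 hpy] using hz
    have hx1 : ∃! w, G.Adj x w := by
      by_contra h
      exact (mem_filter.1 hx').2 (hdom x h)
    obtain ⟨y, hxy, hy⟩ := hx x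
    refine lt_of_eq_of_lt ?_ (Nat.lt_of_succ_le hk)
    refine card_eq_zero.2 (eq_empty_of_forall_notMem fun z hz ↦ ?_)
    obtain ⟨hz, hxz⟩ := mem_filter.1 hz
    exact (mem_filter.1 hz).2 (hdom z (hx1.unique hxy hxz ▸ hy))
  have hle := add_le_add (key (fun v ↦ Even (R.depth v)) hpar)
    (key (fun v ↦ ¬ Even (R.depth v)) fun x y h ↦ not_congr (hpar x y h))
  rw [card_filter_add_card_filter_not] at hle
  omega

lemma Rooting.isLower_univ [Fintype V] (R : Rooting G) : R.IsLower univ := fun _ _ ↦ mem_univ _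

/-- Rooting at a leaf absorbs the `+ 1` of `Rooting.exists_isolatesOn_ends`: the root is a leaf but
not an end, while all ends are leaves. -/
theorem mul_iotaStar_le_card_add_leafOrder {k C : ℕ} [Fintype V] (hG : G.IsTree)
    (hk : 1 ≤ k) (hC : C ≤ 2 * k + 1 ∨ k = 1 ∧ C ≤ 4) :
    C * iotaStar k G ≤ Fintype.card V + leafOrder G := by
  by_cases hV : Fintype.card V ≤ 1
  · rw [iotaStar_eq_zero (starFreeOn_of_card_le (hV.trans hk))]
    simp
  have : Nontrivial V := Fintype.one_lt_card_iff_nontrivial.1 (not_le.1 hV)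
  obtain ⟨r, hr⟩ := hG.exists_vert_degree_one_of_nontrivial
  obtain ⟨R, rfl⟩ := exists_rooting hG r
  obtain ⟨D, hD, hDc⟩ := Rooting.exists_isolatesOn_ends hC R.isLower_univ
  refine (Nat.mul_le_mul_left C (iotaStar_le hD)).trans (hDc.trans ?_)
  rw [card_univ, add_assoc, leafOrder_eq_card]
  refine Nat.add_le_add_left ?_ _
  have hleaf := SimpleGraph.degree_eq_one_iff_existsUnique_adj.1 hr
  have hroot : R.root ∉ R.ends univ := by
    intro h
    obtain ⟨y, hy, -⟩ := hleaf
    rcases (R.adj_iff _ _).1 hy with h' | h'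
    · exact h'.1 rfl
    · exact notMem_empty y ((Rooting.mem_ends.1 h).2 ▸ Rooting.mem_children.2 ⟨mem_univ y, h'⟩)
  rw [← card_insert_of_notMem hroot]
  refine card_le_card (insert_subset (by simpa using hleaf) fun x hx ↦ ?_)
  have hxr : x ≠ R.root := fun h ↦ hroot (h ▸ hx)
  refine mem_filter.2 ⟨mem_univ x, R.parent x, (Rooting.adj_parent hxr).symm, fun y hy ↦ ?_⟩
  rcases (R.adj_iff _ _).1 hy with h' | h'
  · exact h'.2.symm
  · exact absurd ((Rooting.mem_ends.1 hx).2 ▸ Rooting.mem_children.2 ⟨mem_univ y, h'⟩)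
      (notMem_empty y)

/-- The order `k + 1`, excluded from the induction, is harmless: a copy of `K_{1,k}` would span the
tree and make it a star. -/
theorem mul_iotaStar_le_card {k : ℕ} [Fintype V] (hG : G.IsTree)
    (hstar : ¬ IsStarWithAtLeast k G) : (k + 2) * iotaStar k G ≤ Fintype.card V := by
  by_cases hV : Fintype.card V = k + 1
  · suffices StarFreeOn k G univ by
      rw [iotaStar_eq_zero this]
      simp
    by_contra h
    simp only [StarFreeOn, not_forall, not_lt] at h
    obtain ⟨x, -, hx⟩ := h
    refine hstar (isStarWithAtLeast_of_universal hG (x := x) (fun y hy ↦ ?_) hV.ge)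
    have hsub : ({y | G.Adj x y} : Finset V) ⊆ univ.erase x := fun z hz ↦
      mem_erase.2 ⟨(mem_filter.1 hz).2.ne', mem_univ z⟩
    have heq := eq_of_subset_of_card_le hsub (by
      rw [card_erase_of_mem (mem_univ x), card_univ, hV]
      exact hx)
    exact (mem_filter.1 (heq ▸ mem_erase.2 ⟨hy, mem_univ y⟩)).2
  · obtain ⟨R, -⟩ := exists_rooting hG hG.connected.nonempty.some
    obtain ⟨D, hD, hDc⟩ := Rooting.exists_isolatesOn_card (k := k) R.isLower_univ hV
    exact (Nat.mul_le_mul_left _ (iotaStar_le hD)).trans hDc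

end Trees

/-! ### Lower bounds by packing, and graphs given by parents -/

/-- Colours encode disjointness: the closed neighbourhood of the `c`-th star is monochromatic of
colour `c`, and a set `D` missing that colour leaves the whole star undominated. -/
lemma le_iotaStar_of_packing {V : Type*} [Fintype V] {G : SimpleGraph V} {k r : ℕ} (col : V → ℕ)
    (h : ∀ c < r, ∃ x, ∃ W : Finset V, k ≤ #W ∧ (∀ y ∈ W, G.Adj x y) ∧
      ∀ y, y = x ∨ y ∈ W → ∀ z, z = y ∨ G.Adj z y → col z = c) : r ≤ iotaStar k G := by
  refine le_iotaStar fun D hD ↦ ?_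
  rw [← card_range r]
  refine (card_le_card fun c hc ↦ ?_).trans (card_image_le (f := col))
  obtain ⟨x, W, hk, hW, hcol⟩ := h c (mem_range.1 hc)
  by_contra hcD
  have hfar : ∀ y, y = x ∨ y ∈ W → y ∉ closedNbhd G (D : Set V) := by
    rintro y hy (hyD | ⟨u, hu, huy⟩)
    · exact hcD (mem_image.2 ⟨y, hyD, hcol y hy y (Or.inl rfl)⟩)
    · exact hcD (mem_image.2 ⟨u, hu, hcol y hy u (Or.inr huy)⟩)
  have h1 := hD x (by simpa using hfar x (Or.inl rfl))
  refine absurd (hk.trans (card_le_card fun y hy ↦ ?_)) h1.not_ge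
  simpa [hW y hy] using hfar y (Or.inr hy)

lemma le_leafOrder_add_one_of_isStarWithAtLeast {V : Type*} [Fintype V] {G : SimpleGraph V} {k : ℕ}
    (h : IsStarWithAtLeast k G) : Fintype.card V ≤ leafOrder G + 1 := by
  obtain ⟨m, -, ⟨e⟩⟩ := h
  rw [leafOrder_congr e, Fintype.card_congr e.toEquiv, leafOrder_eq_card,
    ← card_univ, ← card_erase_add_one (mem_univ (0 : Fin (m + 1)))]
  refine Nat.add_le_add_right (card_le_card fun x hx ↦ ?_) 1
  have hx0 : x ≠ 0 := (mem_erase.1 hx).1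
  refine mem_filter.2 ⟨mem_univ x, 0, ?_, fun y hy ↦ ?_⟩
  · exact SimpleGraph.starGraph_adj.2 ⟨hx0, Or.inr rfl⟩
  · exact (SimpleGraph.starGraph_adj.1 hy).2.resolve_left hx0

/-- The graph that joins every vertex but the root to its parent. -/
def parentGraph {V : Type*} (root : V) (parent : V → V) : SimpleGraph V :=
  SimpleGraph.fromRel fun u v ↦ u ≠ root ∧ parent u = v

/-- The rooting of a graph given by parents. -/
def parentGraphRooting {V : Type*} (root : V) (parent : V → V) (depth : V → ℕ)
    (hroot : parent root = root) (hdepth : ∀ v, v ≠ root → depth (parent v) + 1 = depth v) :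
    Rooting (parentGraph root parent) where
  root := root
  parent := parent
  depth := depth
  parent_root := hroot
  depth_parent := hdepth
  adj_iff u v := by
    simp only [parentGraph, SimpleGraph.fromRel_adj, and_iff_right_iff_imp]
    rintro h rfl
    have h' : u ≠ root ∧ parent u = u := h.elim id id
    have := hdepth u h'.1
    rw [h'.2] at this
    omega

/-! ### Combs: a path of tooth bottoms with pendant vertices on the teeth -/

section Comb

/-- The vertices of a comb: `⟨i, s, 0⟩` is the vertex of height `s` on the `i`-th tooth, and
`⟨i, s, j + 1⟩` is a pendant vertex attached to it. -/
abbrev CombVertex : Type := (_ : ℕ) × (_ : ℕ) × ℕ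

/-- The parent of a vertex of a comb. -/
def combParent : CombVertex → CombVertex
  | ⟨i, s, _ + 1⟩ => ⟨i, s, 0⟩
  | ⟨i, s + 1, 0⟩ => ⟨i, s, 0⟩
  -- Truncated subtraction makes `⟨0, 0, 0⟩` its own parent, as a root must be.
  | ⟨i, 0, 0⟩ => ⟨i - 1, 0, 0⟩

/-- The distance of a vertex of a comb from the bottom of the first tooth. -/
def combDepth (x : CombVertex) : ℕ := x.1 + x.2.1 + min x.2.2 1

/-- The vertex set of the comb with `t` teeth of `m i` vertices, where `w i s` pendant vertices are
attached to the vertex of height `s` on the `i`-th tooth. -/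
def combSet (t : ℕ) (m : ℕ → ℕ) (w : ℕ → ℕ → ℕ) : Finset CombVertex :=
  (range t).sigma fun i ↦ (range (m i)).sigma fun s ↦ range (w i s + 1)

variable {t : ℕ} {m : ℕ → ℕ} {w : ℕ → ℕ → ℕ}

lemma mem_combSet {i s j : ℕ} : (⟨i, s, j⟩ : CombVertex) ∈ combSet t m w ↔
    i < t ∧ s < m i ∧ j ≤ w i s := by
  simp [combSet]

lemma combParent_mem (hm : ∀ i < t, 2 ≤ m i) {x : CombVertex} (hx : x ∈ combSet t m w) :
    combParent x ∈ combSet t m w := by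
  obtain ⟨i, s, j⟩ := x
  obtain ⟨h1, h2, h3⟩ := mem_combSet.1 hx
  rcases j with _ | j
  · rcases s with _ | s
    · have := hm (i - 1) (by omega)
      exact mem_combSet.2 ⟨by omega, by omega, by omega⟩
    · exact mem_combSet.2 ⟨by omega, by omega, by omega⟩
  · exact mem_combSet.2 ⟨by omega, by omega, by omega⟩

lemma combDepth_combParent {x : CombVertex} (hx : x ≠ ⟨0, 0, 0⟩) :
    combDepth (combParent x) + 1 = combDepth x := by
  obtain ⟨i, s, j⟩ := x
  rcases j with _ | j
  · rcases s with _ | s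
    · rcases i with _ | i
      · exact absurd rfl hx
      · simp [combParent, combDepth]
    · simp [combParent, combDepth, add_assoc]
  · simp [combParent, combDepth]

/-- The comb with `t` teeth of `m i` vertices and `w i s` pendant vertices at each of them. -/
def comb (ht : 0 < t) (hm : ∀ i < t, 2 ≤ m i) : SimpleGraph (combSet t m w) :=
  parentGraph ⟨⟨0, 0, 0⟩, mem_combSet.2 ⟨ht, by have := hm 0 ht; omega, by omega⟩⟩
    fun x ↦ ⟨combParent x, combParent_mem hm x.2⟩

variable (ht : 0 < t) (hm : ∀ i < t, 2 ≤ m i)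

/-- The rooting of a comb at the bottom of its first tooth. -/
def combRooting : Rooting (comb (w := w) ht hm) :=
  parentGraphRooting _ _ (fun x ↦ combDepth x) (Subtype.ext rfl) fun _ hx ↦
    combDepth_combParent fun h ↦ hx (Subtype.ext h)

lemma comb_adj {x y : combSet t m w} : (comb ht hm).Adj x y ↔
    ((x : CombVertex) ≠ ⟨0, 0, 0⟩ ∧ combParent x = y) ∨
    ((y : CombVertex) ≠ ⟨0, 0, 0⟩ ∧ combParent y = x) := by
  rw [(combRooting ht hm).adj_iff]
  simp only [ne_eq, Subtype.ext_iff]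
  rfl

lemma comb_adj_mk {i s j i' s' j' : ℕ} (hx : (⟨i, s, j⟩ : CombVertex) ∈ combSet t m w)
    (hy : (⟨i', s', j'⟩ : CombVertex) ∈ combSet t m w) :
    (comb ht hm).Adj ⟨_, hx⟩ ⟨_, hy⟩ ↔ (i = i' ∧ s = s' ∧ (0 < j ∧ j' = 0 ∨ j = 0 ∧ 0 < j')) ∨
      (j = 0 ∧ j' = 0 ∧ (i = i' ∧ (s + 1 = s' ∨ s' + 1 = s) ∨
        s = 0 ∧ s' = 0 ∧ (i + 1 = i' ∨ i' + 1 = i))) := by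
  have key : ∀ i s j i' s' j' : ℕ, ((⟨i, s, j⟩ : CombVertex) ≠ ⟨0, 0, 0⟩ ∧
      combParent ⟨i, s, j⟩ = ⟨i', s', j'⟩) ↔ i = i' ∧ s = s' ∧ 0 < j ∧ j' = 0 ∨ j = 0 ∧ j' = 0 ∧
        (i = i' ∧ s' + 1 = s ∨ s = 0 ∧ s' = 0 ∧ i' + 1 = i) := by
    intro i s j i' s' j'
    rcases j with _ | j
    · rcases s with _ | s
      · simp only [combParent, ne_eq, Sigma.mk.injEq, heq_eq_eq, true_and, and_true]
        omega
      · simp only [combParent, ne_eq, Sigma.mk.injEq, heq_eq_eq, true_and, and_true]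
        omega
    · simp only [combParent, ne_eq, Sigma.mk.injEq, heq_eq_eq]
      omega
  rw [comb_adj, key, key]
  omega

lemma card_combSet : Fintype.card (combSet t m w) =
    ∑ i ∈ range t, ∑ s ∈ range (m i), (w i s + 1) := by
  rw [Fintype.card_coe]
  simp [combSet, card_sigma]

/-- Under `hw`, a tooth vertex without pendants is neither a top nor the bottom of a sole tooth.
Thus every tooth vertex has degree at least two, and exactly the pendants are leaves. -/
lemma existsUnique_comb_adj_iff
    (hw : ∀ i < t, ∀ s < m i, w i s = 0 → s + 1 < m i ∧ (0 < s ∨ 2 ≤ t)) {i s j : ℕ}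
    (hx : (⟨i, s, j⟩ : CombVertex) ∈ combSet t m w) :
    (∃! y, (comb ht hm).Adj ⟨_, hx⟩ y) ↔ 0 < j := by
  obtain ⟨h1, h2, h3⟩ := mem_combSet.1 hx
  constructor
  · intro hu
    refine Nat.pos_of_ne_zero ?_
    rintro rfl
    have key : ∀ i₁ s₁ j₁ i₂ s₂ j₂ : ℕ, i₁ < t ∧ s₁ < m i₁ ∧ j₁ ≤ w i₁ s₁ →
        i₂ < t ∧ s₂ < m i₂ ∧ j₂ ≤ w i₂ s₂ → (i₁ ≠ i₂ ∨ s₁ ≠ s₂ ∨ j₁ ≠ j₂) →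
        (i = i₁ ∧ s = s₁ ∧ 0 < j₁ ∨ j₁ = 0 ∧ (i = i₁ ∧ (s + 1 = s₁ ∨ s₁ + 1 = s) ∨
          s = 0 ∧ s₁ = 0 ∧ (i + 1 = i₁ ∨ i₁ + 1 = i))) →
        (i = i₂ ∧ s = s₂ ∧ 0 < j₂ ∨ j₂ = 0 ∧ (i = i₂ ∧ (s + 1 = s₂ ∨ s₂ + 1 = s) ∨
          s = 0 ∧ s₂ = 0 ∧ (i + 1 = i₂ ∨ i₂ + 1 = i))) → False := by
      intro i₁ s₁ j₁ i₂ s₂ j₂ hy hz hne h h'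
      have := hu.unique ((comb_adj_mk ht hm hx (mem_combSet.2 hy)).2 (by omega))
        ((comb_adj_mk ht hm hx (mem_combSet.2 hz)).2 (by omega))
      simp only [Subtype.mk.injEq, Sigma.mk.injEq, heq_eq_eq] at this
      omega
    have hm2 := hm i h1
    by_cases hw0 : w i s = 0
    · obtain ⟨h4, h5⟩ := hw i h1 s h2 hw0
      rcases Nat.eq_zero_or_pos s with rfl | hs
      · rcases Nat.eq_zero_or_pos i with rfl | hi
        · have := hm 1 (by omega)
          exact key 0 1 0 1 0 0 (by omega) (by omega) (by omega) (by omega) (by omega)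
        · have := hm (i - 1) (by omega)
          exact key i 1 0 (i - 1) 0 0 (by omega) (by omega) (by omega) (by omega) (by omega)
      · exact key i (s + 1) 0 i (s - 1) 0 (by omega) (by omega) (by omega) (by omega) (by omega)
    · rcases Nat.eq_zero_or_pos s with rfl | hs
      · exact key i 0 1 i 1 0 (by omega) (by omega) (by omega) (by omega) (by omega)
      · exact key i s 1 i (s - 1) 0 (by omega) (by omega) (by omega) (by omega) (by omega)
  · intro hj
    refine ⟨⟨⟨i, s, 0⟩, mem_combSet.2 ⟨h1, h2, Nat.zero_le _⟩⟩, ?_, ?_⟩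
    · exact (comb_adj_mk ht hm _ _).2 (by omega)
    · rintro ⟨⟨i', s', j'⟩, hy⟩ h
      have := (comb_adj_mk ht hm _ _).1 h
      simp only [Subtype.mk.injEq, Sigma.mk.injEq, heq_eq_eq]
      omega

lemma leafOrder_comb
    (hw : ∀ i < t, ∀ s < m i, w i s = 0 → s + 1 < m i ∧ (0 < s ∨ 2 ≤ t)) :
    leafOrder (comb (w := w) ht hm) = ∑ i ∈ range t, ∑ s ∈ range (m i), w i s := by
  have h : Subtype.val '' {x | ∃! y, (comb (w := w) ht hm).Adj x y} =
      (((range t).sigma fun i ↦ (range (m i)).sigma fun s ↦ Ioc 0 (w i s) : Finset CombVertex) :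
        Set CombVertex) := by
    ext ⟨i, s, j⟩
    rw [mem_coe, mem_sigma, mem_sigma, mem_Ioc, mem_range, mem_range]
    constructor
    · rintro ⟨⟨_, hx⟩, hu, rfl⟩
      obtain ⟨h1, h2, h3⟩ := mem_combSet.1 hx
      exact ⟨h1, h2, (existsUnique_comb_adj_iff ht hm hw hx).1 hu, h3⟩
    · rintro ⟨h1, h2, h3, h4⟩
      exact ⟨⟨_, mem_combSet.2 ⟨h1, h2, h4⟩⟩, (existsUnique_comb_adj_iff ht hm hw _).2 h3, rfl⟩
  rw [leafOrder, ← Set.ncard_image_of_injective _ Subtype.val_injective, h, Set.ncard_coe_finset]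
  simp [card_sigma]

/-- A lower bound for the isolation number of a comb: for each colour `c` there is a star whose
centre is at height `s` of some tooth, whose edges go to the pendant vertices and to the heights
in `A`, and whose closed neighbourhood has colour `c`. -/
lemma le_iotaStar_comb {k r : ℕ} (col : ℕ → ℕ → ℕ)
    (h : ∀ c < r, ∃ i < t, ∃ s < m i, ∃ A : Finset ℕ, k ≤ w i s + #A ∧
      (∀ a ∈ A, a < m i ∧ (s + 1 = a ∨ a + 1 = s)) ∧
      ∀ a ∈ insert s A, (0 < a ∨ t = 1) ∧
        ∀ b < m i, a ≤ b + 1 → b ≤ a + 1 → col i b = c) :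
    r ≤ iotaStar k (comb (w := w) ht hm) := by
  refine le_iotaStar_of_packing (fun x ↦ col (x : CombVertex).1 (x : CombVertex).2.1) fun c hc ↦ ?_
  obtain ⟨i, hi, s, hs, A, hk, hA, hcol⟩ := h c hc
  let L : Finset CombVertex := (Ioc 0 (w i s)).image (fun j ↦ ⟨i, s, j⟩)
  let B : Finset CombVertex := A.image (fun a ↦ ⟨i, a, 0⟩)
  have hL : #L = w i s := by
    rw [card_image_of_injective _ fun a b h ↦ by simpa using h, Nat.card_Ioc, Nat.sub_zero]
  have hB : #B = #A := card_image_of_injective _ fun a b h ↦ by simpa using h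
  have hLB : Disjoint L B := by
    simp only [L, B, disjoint_left, mem_image, mem_Ioc]
    rintro _ ⟨j, hj, rfl⟩ ⟨a, -, h⟩
    simp only [Sigma.mk.injEq, heq_eq_eq] at h
    omega
  have hsub : ∀ x ∈ L ∪ B, x ∈ combSet t m w := by
    intro x hx
    rcases mem_union.1 hx with hx | hx
    · obtain ⟨j, hj, rfl⟩ := mem_image.1 hx
      exact mem_combSet.2 ⟨hi, hs, (mem_Ioc.1 hj).2⟩
    · obtain ⟨a, ha, rfl⟩ := mem_image.1 hx
      exact mem_combSet.2 ⟨hi, (hA a ha).1, Nat.zero_le _⟩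
  refine ⟨⟨⟨i, s, 0⟩, mem_combSet.2 ⟨hi, hs, Nat.zero_le _⟩⟩, (L ∪ B).subtype (· ∈ combSet t m w),
    ?_, ?_, ?_⟩
  · rw [card_subtype, filter_true_of_mem hsub, card_union_of_disjoint hLB, hL, hB]
    exact hk
  · rintro ⟨y, hy⟩ hyW
    rcases mem_union.1 (mem_subtype.1 hyW) with h | h
    · obtain ⟨j, hj, rfl⟩ := mem_image.1 h
      have := mem_Ioc.1 hj
      exact (comb_adj_mk ht hm _ _).2 (by omega)
    · obtain ⟨a, ha, rfl⟩ := mem_image.1 h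
      have := (hA a ha).2
      exact (comb_adj_mk ht hm _ _).2 (by omega)
  · rintro ⟨⟨i', a, j⟩, hy⟩ hyW ⟨⟨i'', b, j'⟩, hz⟩ hzy
    have hya : i' = i ∧ (j = 0 ∧ a ∈ insert s A ∨ 0 < j ∧ a = s) := by
      rcases hyW with h | h
      · simp only [Subtype.mk.injEq, Sigma.mk.injEq, heq_eq_eq] at h
        exact ⟨h.1, Or.inl ⟨h.2.2, h.2.1 ▸ mem_insert_self _ _⟩⟩
      · rcases mem_union.1 (mem_subtype.1 h) with h | h
        · obtain ⟨j₁, hj, h⟩ := mem_image.1 h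
          simp only [Sigma.mk.injEq, heq_eq_eq] at h
          have := mem_Ioc.1 hj
          exact ⟨h.1.symm, Or.inr ⟨by omega, h.2.1.symm⟩⟩
        · obtain ⟨a₁, ha, h⟩ := mem_image.1 h
          simp only [Sigma.mk.injEq, heq_eq_eq] at h
          exact ⟨h.1.symm, Or.inl ⟨h.2.2.symm, mem_insert_of_mem (h.2.1 ▸ ha)⟩⟩
    have haA : a ∈ insert s A := by
      rcases hya.2 with h | h
      · exact h.2
      · exact h.2 ▸ mem_insert_self _ _
    obtain ⟨rfl, hya⟩ := hya
    obtain ⟨hat, hcol⟩ := hcol a haA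
    obtain ⟨hz1, hz2, hz3⟩ := mem_combSet.1 hz
    have hib : i'' = i' ∧ a ≤ b + 1 ∧ b ≤ a + 1 := by
      rcases hzy with h | h
      · simp only [Subtype.mk.injEq, Sigma.mk.injEq, heq_eq_eq] at h
        omega
      · have := (comb_adj_mk ht hm _ _).1 h
        omega
    obtain ⟨rfl, h1, h2⟩ := hib
    exact hcol b hz2 h1 h2

/-- The comb as a graph on `Fin n`. -/
theorem exists_tree_fin_of_comb {k r : ℕ} (ht : 0 < t) (hm : ∀ i < t, 2 ≤ m i)
    (hw : ∀ i < t, ∀ s < m i, w i s = 0 → s + 1 < m i ∧ (0 < s ∨ 2 ≤ t)) (col : ℕ → ℕ → ℕ)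
    (h : ∀ c < r, ∃ i < t, ∃ s < m i, ∃ A : Finset ℕ, k ≤ w i s + #A ∧
      (∀ a ∈ A, a < m i ∧ (s + 1 = a ∨ a + 1 = s)) ∧
      ∀ a ∈ insert s A, (0 < a ∨ t = 1) ∧
        ∀ b < m i, a ≤ b + 1 → b ≤ a + 1 → col i b = c) {n ℓ : ℕ}
    (hn : ∑ i ∈ range t, ∑ s ∈ range (m i), (w i s + 1) = n)
    (hℓ : ∑ i ∈ range t, ∑ s ∈ range (m i), w i s = ℓ) :
    ∃ T : SimpleGraph (Fin n), T.IsTree ∧ leafOrder T = ℓ ∧ r ≤ iotaStar k T := by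
  let e : combSet t m w ≃ Fin n := Fintype.equivFinOfCardEq (card_combSet.trans hn)
  let f : comb ht hm ≃g (comb ht hm).map e.toEmbedding := SimpleGraph.Iso.map e _
  refine ⟨_, f.isTree_iff.1 (combRooting ht hm).isTree, ?_, ?_⟩
  · rw [← leafOrder_congr f, leafOrder_comb ht hm hw, hℓ]
  · rw [iotaStar, ← isolationNumber_congr f]
    exact le_iotaStar_comb ht hm col h

end Comb

/-- A tooth with `m` vertices and `w s` pendant vertices at height `s` contains a star `K_{1,k}`
whose closed neighbourhood lies at heights that satisfy `P`. The star may reach the bottom of the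
tooth only if `bottom` holds. -/
def ToothHasStar (k m : ℕ) (w : ℕ → ℕ) (bottom : Prop) (P : ℕ → Prop) : Prop :=
  ∃ s < m, ∃ A : Finset ℕ, k ≤ w s + #A ∧ (∀ a ∈ A, a < m ∧ (s + 1 = a ∨ a + 1 = s)) ∧
    ∀ a ∈ insert s A, (0 < a ∨ bottom) ∧ ∀ b < m, a ≤ b + 1 → b ≤ a + 1 → P b

lemma sum_range_teeth (t m₀ m₁ : ℕ) (f : ℕ → ℕ → ℕ) (f₀ f₁ : ℕ → ℕ) (h₀ : f 0 = f₀)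
    (h₁ : ∀ i, f (i + 1) = f₁) :
    ∑ i ∈ range (t + 1), ∑ s ∈ range (if i = 0 then m₀ else m₁), f i s =
      t * ∑ s ∈ range m₁, f₁ s + ∑ s ∈ range m₀, f₀ s := by
  rw [sum_range_succ']
  simp [h₀, h₁]

/-- The tree obtained from a comb whose teeth but the first are all alike. -/
theorem exists_tree_fin_of_teeth {k r t m₀ m₁ q n ℓ : ℕ} {w₀ w₁ : ℕ → ℕ} (hm₀ : 2 ≤ m₀)
    (hm₁ : 2 ≤ m₁) (hw₀ : ∀ s < m₀, w₀ s = 0 → s + 1 < m₀ ∧ (0 < s ∨ 1 ≤ t))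
    (hw₁ : ∀ s < m₁, w₁ s = 0 → s + 1 < m₁)
    (hs₀ : ToothHasStar k m₀ w₀ (t = 0) (· < q)) (hs₁ : ToothHasStar k m₁ w₁ False fun _ ↦ True)
    (hr : r = t + 1 ∨ r = t + 2 ∧ ToothHasStar k m₀ w₀ (t = 0) (q ≤ ·))
    (hn : t * ∑ s ∈ range m₁, (w₁ s + 1) + ∑ s ∈ range m₀, (w₀ s + 1) = n)
    (hℓ : t * ∑ s ∈ range m₁, w₁ s + ∑ s ∈ range m₀, w₀ s = ℓ) :
    ∃ T : SimpleGraph (Fin n), T.IsTree ∧ leafOrder T = ℓ ∧ r ≤ iotaStar k T := by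
  refine exists_tree_fin_of_comb (t := t + 1) (m := fun i ↦ if i = 0 then m₀ else m₁)
    (w := fun i s ↦ if i = 0 then w₀ s else w₁ s) (by omega) (fun i _ ↦ ?_) (fun i hi s hs hw ↦ ?_)
    -- A tooth is coloured by its index, except that the part of the first tooth from height `q`
    -- upwards gets the colour `t + 1` and may hold a second star.
    (fun i b ↦ if i = 0 ∧ q ≤ b then t + 1 else i) (fun c hc ↦ ?_) ?_ ?_
  · split_ifs <;> assumption
  · by_cases h : i = 0
    · simp only [h, if_true] at hs hw ⊢
      have := hw₀ s hs hw
      omega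
    · simp only [h, if_false] at hs hw ⊢
      have := hw₁ s hs hw
      omega
  · by_cases hct : c = t + 1
    · obtain ⟨s, hs, A, hk, hA, h⟩ := (hr.resolve_left (by omega)).2
      refine ⟨0, by omega, s, by simpa using hs, A, by simpa using hk, by simpa using hA,
        fun a ha ↦ ⟨?_, fun b hb h1 h2 ↦ ?_⟩⟩
      · have := (h a ha).1
        omega
      · rw [if_pos ⟨rfl, (h a ha).2 b (by simpa using hb) h1 h2⟩, hct]
    · by_cases hc0 : c = 0
      · obtain ⟨s, hs, A, hk, hA, h⟩ := hs₀
        refine ⟨0, by omega, s, by simpa using hs, A, by simpa using hk, by simpa using hA,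
          fun a ha ↦ ⟨?_, fun b hb h1 h2 ↦ ?_⟩⟩
        · have := (h a ha).1
          omega
        · rw [if_neg fun h' ↦ (h'.2.trans_lt ((h a ha).2 b (by simpa using hb) h1 h2)).false, hc0]
      · obtain ⟨s, hs, A, hk, hA, h⟩ := hs₁
        refine ⟨c, by omega, s, by simpa [hc0] using hs, A, by simpa [hc0] using hk,
          by simpa [hc0] using hA, fun a ha ↦ ⟨?_, fun b hb h1 h2 ↦ ?_⟩⟩
        · exact Or.inl ((h a ha).1.resolve_right id)
        · rw [if_neg fun h' ↦ hc0 h'.1]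
  · rw [sum_range_teeth t m₀ m₁ _ (fun s ↦ w₀ s + 1) (fun s ↦ w₁ s + 1), hn]
    · simp
    · simp
  · rw [sum_range_teeth t m₀ m₁ _ w₀ w₁, hℓ]
    · simp
    · simp

/-! ### The extremal families -/

section Families

variable {k : ℕ}

/-- `r` teeth with two vertices, `a` pendant vertices at the bottom and `k` at the top. -/
lemma exists_tree_short_teeth {r a : ℕ} (hk : 1 ≤ k) (hr : 1 ≤ r) (har : 1 ≤ a ∨ 2 ≤ r) :
    ∃ T : SimpleGraph (Fin (r * (a + k + 2))), T.IsTree ∧ leafOrder T = r * (a + k) ∧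
      r ≤ iotaStar k T := by
  obtain ⟨t, rfl⟩ := Nat.exists_eq_add_of_le' hr
  have hstar : ∀ b P, (∀ s, s < 2 → P s) →
      ToothHasStar k 2 (fun s ↦ if s = 0 then a else k) b P := fun b P hP ↦
    ⟨1, by omega, ∅, by simp, by simp, by simpa using fun s hs _ ↦ hP s hs⟩
  refine exists_tree_fin_of_teeth (t := t) (m₀ := 2) (m₁ := 2) (q := 2)
    (w₀ := fun s ↦ if s = 0 then a else k) (w₁ := fun s ↦ if s = 0 then a else k) le_rfl le_rfl
    ?_ ?_ (hstar _ _ fun _ ↦ id) (hstar _ _ fun _ _ ↦ trivial) (Or.inl rfl) ?_ ?_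
  · intro s hs h
    split_ifs at h
    all_goals omega
  · intro s hs h
    split_ifs at h
    all_goals omega
  · simp [sum_range_succ]
    ring
  · simp [sum_range_succ]
    ring

/-- A double star. -/
lemma exists_tree_double_star (hk : 1 ≤ k) : ∃ T : SimpleGraph (Fin (k + 3)), T.IsTree ∧
    leafOrder T = k + 1 ∧ 1 ≤ iotaStar (k + 1) T := by
  refine exists_tree_fin_of_teeth (t := 0) (m₀ := 2) (m₁ := 2) (q := 2)
    (w₀ := fun s ↦ if s = 0 then 1 else k) (w₁ := fun _ ↦ k + 1) le_rfl le_rfl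
    -- The star may use the bottom vertex because there is only one tooth.
    ?_ (by simp) ⟨1, by omega, {0}, by simp, by simp, by simpa using fun s h _ ↦ h⟩
    ⟨1, by omega, ∅, by simp, by simp, by simp⟩ (Or.inl rfl) ?_ ?_
  · intro s hs h
    split_ifs at h
    all_goals omega
  · simp [sum_range_succ]
    ring
  · simp [sum_range_succ]
    ring

/-- The middle vertex serves as the last edge of the star. The bottom is only dominated territory,
so the closed neighbourhood stays within the tooth. -/
lemma toothHasStar_three (b : Prop) {P : ℕ → Prop} (hP : ∀ s < 3, P s) :
    ToothHasStar (k + 1) 3 (fun s ↦ if s = 2 then k else 0) b P :=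
  ⟨2, by omega, {1}, by simp, by simp, by simpa using ⟨fun s h _ _ ↦ hP s h, fun s h _ ↦ hP s h⟩⟩

lemma exists_tree_long_teeth {r : ℕ} (hk : 1 ≤ k) (hr : 2 ≤ r) :
    ∃ T : SimpleGraph (Fin (r * (k + 3))), T.IsTree ∧ leafOrder T = r * k ∧
      r ≤ iotaStar (k + 1) T := by
  obtain ⟨t, rfl⟩ := Nat.exists_eq_add_of_le' hr
  refine exists_tree_fin_of_teeth (t := t + 1) (m₀ := 3) (m₁ := 3) (q := 3)
    (w₀ := fun s ↦ if s = 2 then k else 0) (w₁ := fun s ↦ if s = 2 then k else 0)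
    (by omega) (by omega) ?_ ?_ (toothHasStar_three _ fun _ ↦ id)
    (toothHasStar_three _ fun _ _ ↦ trivial) (Or.inl rfl) ?_ ?_
  · intro s hs h
    split_ifs at h
    all_goals omega
  · intro s hs h
    split_ifs at h
    all_goals omega
  · simp [sum_range_succ]
    ring
  · simp
    ring

/-- Long and short teeth both have `k + 3` vertices but differ by one leaf; mixing them puts `ℓ`
strictly inside the middle range. -/
lemma exists_tree_mixed_teeth {r : ℕ} (hk : 1 ≤ k) (hr : 1 ≤ r) :
    ∃ T : SimpleGraph (Fin ((r + 1) * (k + 3))), T.IsTree ∧ leafOrder T = r * (k + 1) + k ∧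
      r + 1 ≤ iotaStar (k + 1) T := by
  refine exists_tree_fin_of_teeth (t := r) (m₀ := 3) (m₁ := 2) (q := 3)
    (w₀ := fun s ↦ if s = 2 then k else 0) (w₁ := fun s ↦ if s = 1 then k + 1 else 0)
    (by omega) (by omega) ?_ ?_ (toothHasStar_three _ fun _ ↦ id)
    ⟨1, by omega, ∅, by simp, by simp, by simp⟩ (Or.inl rfl) ?_ ?_
  · intro s hs h
    split_ifs at h
    all_goals omega
  · intro s hs h
    split_ifs at h
    all_goals omega
  · simp [sum_range_succ]
    ring
  · simp

/-- In the first tooth, the star centred at height `2` uses both path neighbours. Its share, heights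
`0` to `4`, has one vertex more and one leaf fewer than a three-vertex tooth. So `n + ℓ` stays at
`2k + 5` per star while `ℓ` drops below the threshold. -/
lemma exists_tree_few_leaves {t : ℕ} (ht : 1 ≤ t) :
    ∃ T : SimpleGraph (Fin (t * (k + 4) + 2 * k + 9)), T.IsTree ∧
      leafOrder T = t * (k + 1) + 2 * k + 1 ∧ t + 2 ≤ iotaStar (k + 2) T := by
  refine exists_tree_fin_of_teeth (t := t) (m₀ := 8) (m₁ := 3) (q := 5)
    (w₀ := fun s ↦ if s = 2 then k else if s = 7 then k + 1 else 0)
    (w₁ := fun s ↦ if s = 2 then k + 1 else 0)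
    (by omega) (by omega) ?_ ?_ ⟨2, by omega, {1, 3}, by simp, by simp, ?_⟩
    (toothHasStar_three _ fun _ _ ↦ trivial)
    (Or.inr ⟨rfl, 7, by omega, {6}, by simp, by simp, ?_⟩) ?_ ?_
  · intro s hs h
    split_ifs at h
    all_goals omega
  · intro s hs h
    split_ifs at h
    all_goals omega
  · intro a ha
    simp only [mem_insert, mem_singleton] at ha
    exact ⟨by omega, fun b _ _ _ ↦ by omega⟩
  · intro a ha
    simp only [mem_insert, mem_singleton] at ha
    exact ⟨by omega, fun b _ _ _ ↦ by omega⟩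
  · simp [sum_range_succ]
    ring
  · simp [sum_range_succ]
    ring

/-- The edge between heights `1` and `2` of the first tooth occupies four vertices and no leaf;
every other star occupies three vertices and one leaf. Either way a star costs `4` in `n + ℓ`. -/
lemma exists_tree_few_leaves_one {t : ℕ} (ht : 1 ≤ t) :
    ∃ T : SimpleGraph (Fin (3 * t + 7)), T.IsTree ∧ leafOrder T = t + 1 ∧
      t + 2 ≤ iotaStar 1 T := by
  refine exists_tree_fin_of_teeth (t := t) (m₀ := 6) (m₁ := 2) (q := 4)
    (w₀ := fun s ↦ if s = 5 then 1 else 0) (w₁ := fun s ↦ if s = 1 then 1 else 0)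
    (by omega) (by omega) ?_ ?_ ⟨1, by omega, {2}, by simp, by simp, ?_⟩
    ⟨1, by omega, ∅, by simp, by simp, by simp⟩
    (Or.inr ⟨rfl, 5, by omega, ∅, by simp, by simp, ?_⟩) ?_ ?_
  · intro s hs h
    split_ifs at h
    all_goals omega
  · intro s hs h
    split_ifs at h
    all_goals omega
  · intro a ha
    simp only [mem_insert, mem_singleton] at ha
    exact ⟨by omega, fun b _ _ _ ↦ by omega⟩
  · intro a ha
    simp only [mem_insert, notMem_empty, or_false] at ha
    exact ⟨by omega, fun b _ _ _ ↦ by omega⟩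
  · simp [sum_range_succ]
    ring
  · simp

/-- Since `r ≥ 1` gives `n ≥ ℓ + 2`, the tree is no star and the upper bound applies. -/
lemma iotaStar_eq_of_card_sub_leafOrder {n ℓ r : ℕ} {T : SimpleGraph (Fin n)} (hT : T.IsTree)
    (hk : 1 ≤ k) (hℓ : leafOrder T = ℓ) (hr : r ≤ iotaStar k T) (hr1 : 1 ≤ r)
    (hn : n = ℓ + 2 * r) : iotaStar k T = r := by
  have h := two_mul_iotaStar_add_leafOrder_le hT hk fun h ↦ by
    have := le_leafOrder_add_one_of_isStarWithAtLeast h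
    rw [Fintype.card_fin] at this
    omega
  rw [Fintype.card_fin] at h
  omega

lemma iotaStar_eq_of_card_add_leafOrder {C n ℓ r : ℕ} {T : SimpleGraph (Fin n)} (hT : T.IsTree)
    (hk : 1 ≤ k) (hC : C ≤ 2 * k + 1 ∨ k = 1 ∧ C ≤ 4) (hC1 : 1 ≤ C) (hℓ : leafOrder T = ℓ)
    (hr : r ≤ iotaStar k T) (hn : n + ℓ = C * r) : iotaStar k T = r := by
  have h := mul_iotaStar_le_card_add_leafOrder hT hk hC
  rw [Fintype.card_fin, hℓ, hn] at h
  exact le_antisymm (Nat.le_of_mul_le_mul_left h hC1) hr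

lemma iotaStar_eq_of_card {n ℓ r : ℕ} {T : SimpleGraph (Fin n)} (hT : T.IsTree)
    (hℓ : leafOrder T = ℓ) (hr : r ≤ iotaStar k T) (hn : n = (k + 2) * r)
    (hnℓ : ℓ + 2 ≤ n) : iotaStar k T = r := by
  have h := mul_iotaStar_le_card (k := k) hT fun h ↦ by
    have := le_leafOrder_add_one_of_isStarWithAtLeast h
    rw [Fintype.card_fin] at this
    omega
  exact le_antisymm (Nat.le_of_mul_le_mul_left
    (h.trans_eq ((Fintype.card_fin n).trans hn)) (by omega)) hr

end Families

end Isolation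

/-! ### Assembly of bounds and examples -/

theorem theorem1p4 :
    -- (a), the bounds on the isolation number
    (∀ (V : Type*) [Fintype V] (T : SimpleGraph V) (n ℓ : ℕ), T.IsTree →
      Fintype.card V = n → leafOrder T = ℓ → ¬ IsStarWithAtLeast 1 T →
      ((ℓ : ℝ) < (n : ℝ) / 3 →
        (iota T : ℝ) ≤ ((n : ℝ) + ℓ) / 4 ∧ ((n : ℝ) + ℓ) / 4 < (n : ℝ) / 3) ∧
      ((ℓ : ℝ) = (n : ℝ) / 3 →
        (iota T : ℝ) ≤ ((n : ℝ) + ℓ) / 4 ∧ ((n : ℝ) + ℓ) / 4 = ((n : ℝ) - ℓ) / 2 ∧ ((n : ℝ) - ℓ) / 2 = (n : ℝ) / 3) ∧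
      ((n : ℝ) / 3 < (ℓ : ℝ) →
        (iota T : ℝ) ≤ ((n : ℝ) - ℓ) / 2 ∧ ((n : ℝ) - ℓ) / 2 < (n : ℝ) / 3)) ∧
    -- (b), the bounds on the k-isolation number
    (∀ k : ℕ, 2 ≤ k → ∀ (V : Type*) [Fintype V] (T : SimpleGraph V) (n ℓ : ℕ), T.IsTree →
      Fintype.card V = n → leafOrder T = ℓ → ¬ IsStarWithAtLeast k T →
      ((ℓ : ℝ) < ((k : ℝ) - 1) / (k + 2) * n →
        (iotaStar k T : ℝ) ≤ ((n : ℝ) + ℓ) / (2 * k + 1) ∧ ((n : ℝ) + ℓ) / (2 * k + 1) < (n : ℝ) / (k + 2)) ∧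
      ((ℓ : ℝ) = ((k : ℝ) - 1) / (k + 2) * n →
        (iotaStar k T : ℝ) ≤ ((n : ℝ) + ℓ) / (2 * k + 1) ∧ ((n : ℝ) + ℓ) / (2 * k + 1) = (n : ℝ) / (k + 2)) ∧
      (((k : ℝ) - 1) / (k + 2) * n < (ℓ : ℝ) ∧ (ℓ : ℝ) < (k : ℝ) / (k + 2) * n →
        (iotaStar k T : ℝ) ≤ (n : ℝ) / (k + 2)) ∧
      ((ℓ : ℝ) = (k : ℝ) / (k + 2) * n →
        (iotaStar k T : ℝ) ≤ ((n : ℝ) - ℓ) / 2 ∧ ((n : ℝ) - ℓ) / 2 = (n : ℝ) / (k + 2)) ∧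
      ((k : ℝ) / (k + 2) * n < (ℓ : ℝ) →
        (iotaStar k T : ℝ) ≤ ((n : ℝ) - ℓ) / 2 ∧ ((n : ℝ) - ℓ) / 2 < (n : ℝ) / (k + 2))) ∧
    -- sharpness of each bound in (a)
    (
      (∀ r : ℕ, 3 ≤ r → ∃ (n ℓ : ℕ) (T : SimpleGraph (Fin n)), T.IsTree ∧ leafOrder T = ℓ ∧
        (ℓ : ℝ) < (n : ℝ) / 3 ∧
        (iota T : ℝ) = ((n : ℝ) + ℓ) / 4 ∧ iota T = r) ∧
      (∀ r : ℕ, 2 ≤ r → ∃ (n ℓ : ℕ) (T : SimpleGraph (Fin n)), T.IsTree ∧ leafOrder T = ℓ ∧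
        (ℓ : ℝ) = (n : ℝ) / 3 ∧
        (iota T : ℝ) = ((n : ℝ) + ℓ) / 4 ∧ iota T = r) ∧
      (∀ r : ℕ, 1 ≤ r → ∃ (n ℓ : ℕ) (T : SimpleGraph (Fin n)), T.IsTree ∧ leafOrder T = ℓ ∧
        (n : ℝ) / 3 < (ℓ : ℝ) ∧
        (iota T : ℝ) = ((n : ℝ) - ℓ) / 2 ∧ iota T = r)) ∧
    -- sharpness of each bound in (b), for every k
    (∀ k : ℕ, 2 ≤ k →
      (∀ r : ℕ, 3 ≤ r → ∃ (n ℓ : ℕ) (T : SimpleGraph (Fin n)), T.IsTree ∧ leafOrder T = ℓ ∧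
        (ℓ : ℝ) < ((k : ℝ) - 1) / (k + 2) * n ∧
        (iotaStar k T : ℝ) = ((n : ℝ) + ℓ) / (2 * k + 1) ∧ iotaStar k T = r) ∧
      (∀ r : ℕ, 2 ≤ r → ∃ (n ℓ : ℕ) (T : SimpleGraph (Fin n)), T.IsTree ∧ leafOrder T = ℓ ∧
        (ℓ : ℝ) = ((k : ℝ) - 1) / (k + 2) * n ∧
        (iotaStar k T : ℝ) = ((n : ℝ) + ℓ) / (2 * k + 1) ∧ iotaStar k T = r) ∧
      (∀ r : ℕ, 2 ≤ r → ∃ (n ℓ : ℕ) (T : SimpleGraph (Fin n)), T.IsTree ∧ leafOrder T = ℓ ∧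
        ((k : ℝ) - 1) / (k + 2) * n < (ℓ : ℝ) ∧ (ℓ : ℝ) < (k : ℝ) / (k + 2) * n ∧
        (iotaStar k T : ℝ) = (n : ℝ) / (k + 2) ∧ iotaStar k T = r) ∧
      (∀ r : ℕ, 1 ≤ r → ∃ (n ℓ : ℕ) (T : SimpleGraph (Fin n)), T.IsTree ∧ leafOrder T = ℓ ∧
        (ℓ : ℝ) = (k : ℝ) / (k + 2) * n ∧
        (iotaStar k T : ℝ) = ((n : ℝ) - ℓ) / 2 ∧ iotaStar k T = r) ∧
      (∀ r : ℕ, 1 ≤ r → ∃ (n ℓ : ℕ) (T : SimpleGraph (Fin n)), T.IsTree ∧ leafOrder T = ℓ ∧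
        (k : ℝ) / (k + 2) * n < (ℓ : ℝ) ∧
        (iotaStar k T : ℝ) = ((n : ℝ) - ℓ) / 2 ∧ iotaStar k T = r)) := by

  refine ⟨fun V _ T n ℓ hT hn hℓ hstar ↦ ?_, fun k hk V _ T n ℓ hT hn hℓ hstar ↦ ?_,
    ⟨fun r hr ↦ ?_, fun r hr ↦ ?_, fun r hr ↦ ?_⟩, fun k hk ↦
    ⟨fun r hr ↦ ?_, fun r hr ↦ ?_, fun r hr ↦ ?_, fun r hr ↦ ?_, fun r hr ↦ ?_⟩⟩
  · rw [iota_eq_iotaStar_one]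
    have h1 : (4 : ℝ) * iotaStar 1 T ≤ n + ℓ := by
      have := mul_iotaStar_le_card_add_leafOrder (C := 4) hT le_rfl (Or.inr ⟨rfl, le_rfl⟩)
      rw [hn, hℓ] at this
      exact_mod_cast this
    have h2 : (2 : ℝ) * iotaStar 1 T + ℓ ≤ n := by
      have := two_mul_iotaStar_add_leafOrder_le hT le_rfl hstar
      rw [hn, hℓ] at this
      exact_mod_cast this
    refine ⟨fun h ↦ ⟨?_, ?_⟩, fun h ↦ ⟨?_, ?_, ?_⟩, fun h ↦ ⟨?_, ?_⟩⟩ <;> linarith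
  · have hk0 : (0 : ℝ) < k + 2 := by positivity
    have hk1 : (0 : ℝ) < 2 * k + 1 := by positivity
    have h1 : (2 * k + 1 : ℝ) * iotaStar k T ≤ n + ℓ := by
      have := mul_iotaStar_le_card_add_leafOrder (k := k) hT (by omega) (Or.inl le_rfl)
      rw [hn, hℓ] at this
      exact_mod_cast this
    have h2 : (2 : ℝ) * iotaStar k T + ℓ ≤ n := by
      have := two_mul_iotaStar_add_leafOrder_le hT (by omega) hstar
      rw [hn, hℓ] at this
      exact_mod_cast this
    have h3 : (k + 2 : ℝ) * iotaStar k T ≤ n := by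
      have := mul_iotaStar_le_card hT hstar
      rw [hn] at this
      exact_mod_cast this
    have h4 : (iotaStar k T : ℝ) ≤ (n + ℓ) / (2 * k + 1) := by
      rw [le_div_iff₀ hk1]
      linarith
    have h5 : (iotaStar k T : ℝ) ≤ (n - ℓ) / 2 := by linarith
    have h6 : (iotaStar k T : ℝ) ≤ n / (k + 2) := by
      rw [le_div_iff₀ hk0]
      linarith
    refine ⟨fun h ↦ ⟨h4, ?_⟩, fun h ↦ ⟨h4, ?_⟩, fun _ ↦ h6, fun h ↦ ⟨h5, ?_⟩, fun h ↦ ⟨h5, ?_⟩⟩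
    · rw [div_mul_eq_mul_div, lt_div_iff₀ hk0] at h
      rw [div_lt_div_iff₀ hk1 hk0]
      linarith
    · rw [div_mul_eq_mul_div, eq_div_iff hk0.ne'] at h
      rw [div_eq_div_iff hk1.ne' hk0.ne']
      linarith
    · rw [div_mul_eq_mul_div, eq_div_iff hk0.ne'] at h
      rw [div_eq_div_iff two_ne_zero hk0.ne']
      linarith
    · rw [div_mul_eq_mul_div, div_lt_iff₀ hk0] at h
      rw [div_lt_div_iff₀ two_pos hk0]
      linarith
  · obtain ⟨t, rfl⟩ := Nat.exists_eq_add_of_le' (show 2 ≤ r by omega)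
    obtain ⟨T, hT, hℓ, hι⟩ := exists_tree_few_leaves_one (t := t) (by omega)
    have hι := iotaStar_eq_of_card_add_leafOrder hT le_rfl (Or.inr ⟨rfl, le_rfl⟩) (by norm_num)
      hℓ hι (by ring)
    refine ⟨_, _, T, hT, hℓ, ?_, ?_, ?_⟩
    · push_cast
      linarith
    · rw [iota_eq_iotaStar_one, hι]
      push_cast
      ring
    · rw [iota_eq_iotaStar_one, hι]
  · obtain ⟨T, hT, hℓ, hι⟩ := exists_tree_short_teeth (k := 1) (a := 0) (r := r) le_rfl (by omega)
      (Or.inr hr)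
    have hι := iotaStar_eq_of_card_add_leafOrder hT le_rfl (Or.inr ⟨rfl, le_rfl⟩) (by norm_num)
      hℓ hι (by ring)
    refine ⟨_, _, T, hT, hℓ, ?_, ?_, ?_⟩
    · push_cast
      ring
    · rw [iota_eq_iotaStar_one, hι]
      push_cast
      ring
    · rw [iota_eq_iotaStar_one, hι]
  · obtain ⟨T, hT, hℓ, hι⟩ := exists_tree_short_teeth (k := 1) (a := 1) (r := r) le_rfl hr
      (Or.inl le_rfl)
    have hι := iotaStar_eq_of_card_sub_leafOrder hT le_rfl hℓ hι hr (by ring)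
    have hr0 : (1 : ℝ) ≤ r := by exact_mod_cast hr
    refine ⟨_, _, T, hT, hℓ, ?_, ?_, ?_⟩
    · push_cast
      linarith
    · rw [iota_eq_iotaStar_one, hι]
      push_cast
      ring
    · rw [iota_eq_iotaStar_one, hι]
  · obtain ⟨t, rfl⟩ := Nat.exists_eq_add_of_le' (show 2 ≤ r by omega)
    obtain ⟨k, rfl⟩ := Nat.exists_eq_add_of_le' hk
    obtain ⟨T, hT, hℓ, hι⟩ := exists_tree_few_leaves (k := k) (t := t) (by omega)
    have hι := iotaStar_eq_of_card_add_leafOrder hT (by omega) (Or.inl le_rfl) (by omega)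
      hℓ hι (by ring)
    refine ⟨_, _, T, hT, hℓ, ?_, ?_, hι⟩
    · rw [div_mul_eq_mul_div, lt_div_iff₀ (by positivity)]
      have ht : (1 : ℝ) ≤ t := by exact_mod_cast (by omega : 1 ≤ t)
      push_cast
      nlinarith [(Nat.cast_nonneg k : (0 : ℝ) ≤ k)]
    · rw [hι, eq_div_iff (by positivity)]
      push_cast
      ring
  · obtain ⟨k, rfl⟩ := Nat.exists_eq_add_of_le' (show 1 ≤ k by omega)
    obtain ⟨T, hT, hℓ, hι⟩ := exists_tree_long_teeth (k := k) (by omega) hr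
    have hι := iotaStar_eq_of_card_add_leafOrder hT (by omega) (Or.inl le_rfl) (by omega)
      hℓ hι (by ring)
    refine ⟨_, _, T, hT, hℓ, ?_, ?_, hι⟩
    · rw [div_mul_eq_mul_div, eq_div_iff (by positivity)]
      push_cast
      ring
    · rw [hι, eq_div_iff (by positivity)]
      push_cast
      ring
  · obtain ⟨k, rfl⟩ := Nat.exists_eq_add_of_le' (show 1 ≤ k by omega)
    obtain ⟨r, rfl⟩ := Nat.exists_eq_add_of_le' (show 1 ≤ r by omega)
    obtain ⟨T, hT, hℓ, hι⟩ := exists_tree_mixed_teeth (k := k) (r := r) (by omega) (by omega)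
    have hι := iotaStar_eq_of_card hT hℓ hι (by ring) (by nlinarith)
    have hr0 : (1 : ℝ) ≤ r := by exact_mod_cast (by omega : 1 ≤ r)
    refine ⟨_, _, T, hT, hℓ, ?_, ?_, ?_, hι⟩
    · rw [div_mul_eq_mul_div, div_lt_iff₀ (by positivity)]
      push_cast
      nlinarith [(Nat.cast_nonneg k : (0 : ℝ) ≤ k)]
    · rw [div_mul_eq_mul_div, lt_div_iff₀ (by positivity)]
      push_cast
      nlinarith [(Nat.cast_nonneg k : (0 : ℝ) ≤ k)]
    · rw [hι, eq_div_iff (by positivity)]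
      push_cast
      ring
  · obtain ⟨T, hT, hℓ, hι⟩ : ∃ T : SimpleGraph (Fin (r * (k + 2))), T.IsTree ∧
        leafOrder T = r * k ∧ r ≤ iotaStar k T := by
      -- A single short tooth with `a = 0` would have its bottom as an additional leaf, so `r = 1`
      -- needs the double star.
      rcases hr.eq_or_lt with rfl | hr
      · obtain ⟨k, rfl⟩ := Nat.exists_eq_add_of_le' (show 1 ≤ k by omega)
        rw [one_mul, one_mul]
        exact exists_tree_double_star (by omega)
      · have := exists_tree_short_teeth (k := k) (a := 0) (r := r) (by omega) (by omega) (Or.inr hr)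
        rwa [zero_add] at this
    have hι := iotaStar_eq_of_card_sub_leafOrder hT (by omega) hℓ hι hr (by ring)
    refine ⟨_, _, T, hT, hℓ, ?_, ?_, hι⟩
    · rw [div_mul_eq_mul_div, eq_div_iff (by positivity)]
      push_cast
      ring
    · rw [hι]
      push_cast
      ring
  · obtain ⟨T, hT, hℓ, hι⟩ := exists_tree_short_teeth (k := k) (a := 1) (r := r) (by omega) hr
      (Or.inl le_rfl)
    have hι := iotaStar_eq_of_card_sub_leafOrder hT (by omega) hℓ hι hr (by ring)
    have hr0 : (1 : ℝ) ≤ r := by exact_mod_cast hr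
    refine ⟨_, _, T, hT, hℓ, ?_, ?_, hι⟩
    · rw [div_mul_eq_mul_div, div_lt_iff₀ (by positivity)]
      push_cast
      nlinarith
    · rw [hι]
      push_cast
      ring
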